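/- **Setting.** Let $\mathcal X$ be a Borel subset of $\mathbb R^d$ (more generally a standard Borel space), $k\ge 1$ and $1\le\Lambda<\infty$. Consider laws $Q$ of $(Y(1),Y(0),X,A,U)$ on $\mathbb R^2\times\mathcal X\times\{0,1\}\times\mathbb R^k$ (potential outcomes, covariates, treatment, unobserved confounders), and let $Y=AY(1)+(1-A)Y(0)$ be the observed outcome. Say that $Q$ satisfies the marginal sensitivity model MSM($\Lambda$) if $(Y(0),Y(1))$ is independent of $A$ given $(X,U)$ under $Q$ and, $Q$-almost surely, $$\frac1\Lambda\le\frac{Q(A=1\mid X,U)/Q(A=0\mid X,U)}{Q(A=1\mid X)/Q(A=0\mid X)}\le\Lambda .$$ Let the true law $P_o$ satisfy MSM($\Lambda$) with $\mathbb E_{P_o}|Y(1)|<\infty$ and $\mathbb E_{P_o}|Y(0)|<\infty$, let $P$ be the law of the observed data $(X,Y,A)$ under $P_o$, and let $\mathcal P(\Lambda)$ be the set of all laws $Q$ that satisfy MSM($\Lambda$) and under which $(X,Y,A)$ has law $P$. Write $\mathbb E$ and $\mathbb P$ for expectation and probability under $P$, $e_a(x)=\mathbb P(A=a\mid X=x)$,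 $F(\cdot\mid x,a)$ for the distribution function of $Y$ given $X=x$, $A=a$, and $$q^-_\Lambda(x,a)=\inf\Big\{q: F(q\mid x,a)\ge\tfrac1{1+\Lambda}\Big\},$$ $$\mu^-_\Lambda(x,a)=\mathbb E\Big[Y\,\mathbf 1\{A=a\}\Big(1+\frac{1-e_a(X)}{e_a(X)}\,\Lambda^{-\mathrm{sgn}(Y-q^-_\Lambda(X,a))}\Big)\,\Big|\,X=x\Big],$$ where $\mathrm{sgn}(t)=1$ if $t\ge0$ and $-1$ otherwise. If $\Lambda>1$, assume that for almost every $(x,a)$ the conditional law of $Y$ given $X=x$, $A=a$ has no atom at $q^-_\Lambda(x,a)$, that is, $\mathbb P(Y=q^-_\Lambda(X,A))=0$. A policy is a Borel measurable map $\pi:\mathcal X\to[0,1]$; put $Y(\pi(X))=\pi(X)Y(1)+(1-\pi(X))Y(0)$. **Theorem 1.** 1. For every policy $\pi$, the expectations below exist and are finite, and the worst-case welfare is $$W_\Lambda(\pi):=\inf_{Q\in\mathcal P(\Lambda)}\mathbb E_Q[Y(\pi(X))]=\mathbb E\big[\mu^-_\Lambda(X,1)\pi(X)+\mu^-_\Lambda(X,0)(1-\pi(X))\big].$$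 2. $\mu^-_\Lambda$ is the sharp lower bound on the conditional means of the potential outcomes: for every $Q\in\mathcal P(\Lambda)$ and $a\in\{0,1\}$, $\mathbb E_Q[Y(a)\mid X]\ge\mu^-_\Lambda(X,a)$ almost surely, and there is one $Q\in\mathcal P(\Lambda)$ for which equality holds almost surely for both $a=0$ and $a=1$. 3. The policy $\pi^\star_{W,\Lambda}(x)=\mathbf 1\{\mu^-_\Lambda(x,1)-\mu^-_\Lambda(x,0)>0\}$ is a first-best max-min welfare policy: it maximizes $W_\Lambda$ over the set of all policies. -/

import Mathlib

open MeasureTheory ProbabilityTheory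

noncomputable section

namespace MSMPolicy

/-- Full (counterfactual) data `(Y(1), Y(0), X, A, U)`: potential outcomes, covariates in `𝒳`,
binary treatment (`true` is treatment `1`, `false` is control `0`), and a `k`-dimensional vector of
unobserved confounders. -/
abbrev Full (𝒳 : Type*) (k : ℕ) : Type _ := ℝ × ℝ × 𝒳 × Bool × (Fin k → ℝ)

/-- Observed data `(X, Y, A)`. -/
abbrev Obs (𝒳 : Type*) : Type _ := 𝒳 × ℝ × Bool

namespace Full

variable {𝒳 : Type*} {k : ℕ}

/-- Potential outcome under treatment, `Y(1)`. -/
def Y1 (o : Full 𝒳 k) : ℝ := o.1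

/-- Potential outcome under control, `Y(0)`. -/
def Y0 (o : Full 𝒳 k) : ℝ := o.2.1

/-- Covariates. -/
def X (o : Full 𝒳 k) : 𝒳 := o.2.2.1

/-- Treatment. -/
def A (o : Full 𝒳 k) : Bool := o.2.2.2.1

/-- Unobserved confounders. -/
def U (o : Full 𝒳 k) : Fin k → ℝ := o.2.2.2.2

/-- The potential outcome `Y(a)`. -/
def potential (a : Bool) (o : Full 𝒳 k) : ℝ := if a then Y1 o else Y0 o

/-- The observed data `(X, Y, A)`, where `Y = A Y(1) + (1 - A) Y(0) = Y(A)`. -/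
def observed (o : Full 𝒳 k) : Obs 𝒳 := (X o, potential (A o) o, A o)

variable [MeasurableSpace 𝒳]

lemma measurable_Y1 : Measurable (Y1 : Full 𝒳 k → ℝ) := measurable_fst

lemma measurable_Y0 : Measurable (Y0 : Full 𝒳 k → ℝ) := measurable_fst.comp measurable_snd

lemma measurable_X : Measurable (X : Full 𝒳 k → 𝒳) :=
  measurable_fst.comp (measurable_snd.comp measurable_snd)

lemma measurable_A : Measurable (A : Full 𝒳 k → Bool) :=
  measurable_fst.comp (measurable_snd.comp (measurable_snd.comp measurable_snd))

lemma measurable_U : Measurable (U : Full 𝒳 k → Fin k → ℝ) :=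
  measurable_snd.comp (measurable_snd.comp (measurable_snd.comp measurable_snd))

/-- The σ-algebra generated by the covariates. -/
abbrev sigmaX (𝒳 : Type*) [MeasurableSpace 𝒳] (k : ℕ) : MeasurableSpace (Full 𝒳 k) :=
  MeasurableSpace.comap X inferInstance

/-- The σ-algebra generated by covariates and confounders. -/
abbrev sigmaXU (𝒳 : Type*) [MeasurableSpace 𝒳] (k : ℕ) : MeasurableSpace (Full 𝒳 k) :=
  MeasurableSpace.comap (fun o => (X o, U o)) inferInstance

lemma sigmaX_le : sigmaX 𝒳 k ≤ (inferInstance : MeasurableSpace (Full 𝒳 k)) :=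
  measurable_X.comap_le

lemma sigmaXU_le : sigmaXU 𝒳 k ≤ (inferInstance : MeasurableSpace (Full 𝒳 k)) :=
  (measurable_X.prodMk measurable_U).comap_le

/-- The nominal propensity score `ℙ_Q(A = 1 | X)`, as a random variable. -/
def nominalPropensity (Q : Measure (Full 𝒳 k)) : Full 𝒳 k → ℝ :=
  Q[(A ⁻¹' {true}).indicator (fun _ => (1 : ℝ)) | sigmaX 𝒳 k]

/-- The true propensity score `ℙ_Q(A = 1 | X, U)`, as a random variable. -/
def truePropensity (Q : Measure (Full 𝒳 k)) : Full 𝒳 k → ℝ :=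
  Q[(A ⁻¹' {true}).indicator (fun _ => (1 : ℝ)) | sigmaXU 𝒳 k]

end Full

open Full

section Model

variable {𝒳 : Type*} [MeasurableSpace 𝒳] [StandardBorelSpace 𝒳] {k : ℕ}

/-- The odds `p / (1 - p)`. -/
def odds (p : ℝ) : ℝ := p / (1 - p)

/-- The marginal sensitivity model with parameter `Λ`: the potential outcomes are independent of the
treatment given `(X, U)`, and the odds ratio of the true and the nominal propensity score lies
almost surely in `[1/Λ, Λ]`. (Division by `0` is `0` here, so the lower bound `1/Λ > 0` makes all
these scores lie strictly between `0` and `1`, where the odds ratio is meaningful.) -/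
structure MarginalSensitivity (Λ : ℝ) (Q : Measure (Full 𝒳 k)) [IsFiniteMeasure Q] : Prop where
  condIndep : CondIndepFun (sigmaXU 𝒳 k) sigmaXU_le (fun o => (Y1 o, Y0 o)) A Q
  lower : ∀ᵐ o ∂Q, 1 / Λ ≤ odds (truePropensity Q o) / odds (nominalPropensity Q o)
  upper : ∀ᵐ o ∂Q, odds (truePropensity Q o) / odds (nominalPropensity Q o) ≤ Λ

/-- The uncertainty set `𝒫(Λ)`: all laws of the full data that satisfy the marginal sensitivity
model and whose observed-data law is `P`. -/
def uncertaintySet (k : ℕ) (P : Measure (Obs 𝒳)) (Λ : ℝ) : Set (ProbabilityMeasure (Full 𝒳 k)) :=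
  {Q | MarginalSensitivity Λ (Q : Measure (Full 𝒳 k)) ∧
    (Q : Measure (Full 𝒳 k)).map observed = P}

end Model

section Policies

variable {𝒳 : Type*} [MeasurableSpace 𝒳]

/-- The set of all measurable, possibly randomized policies `π : 𝒳 → [0, 1]`. -/
def allPolicies (𝒳 : Type*) [MeasurableSpace 𝒳] : Set (𝒳 → ℝ) :=
  {π | Measurable π ∧ ∀ x, π x ∈ Set.Icc (0 : ℝ) 1}

/-- `Y(π(X)) = π(X) Y(1) + (1 - π(X)) Y(0)`. -/
def policyOutcome {k : ℕ} (π : 𝒳 → ℝ) (o : Full 𝒳 k) : ℝ :=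
  π (X o) * Y1 o + (1 - π (X o)) * Y0 o

/-- The expected welfares `𝔼_Q[Y(π(X))]` for `Q ∈ 𝒫(Λ)`. -/
def welfareValues [StandardBorelSpace 𝒳] (k : ℕ) (P : Measure (Obs 𝒳)) (Λ : ℝ) (π : 𝒳 → ℝ) :
    Set ℝ :=
  (fun Q : ProbabilityMeasure (Full 𝒳 k) => ∫ o, policyOutcome π o ∂(Q : Measure (Full 𝒳 k))) ''
    uncertaintySet k P Λ

/-- The worst-case welfare `W_Λ(π) = inf_{Q ∈ 𝒫(Λ)} 𝔼_Q[Y(π(X))]`. -/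
def worstCaseWelfare [StandardBorelSpace 𝒳] (k : ℕ) (P : Measure (Obs 𝒳)) (Λ : ℝ) (π : 𝒳 → ℝ) :
    ℝ :=
  sInf (welfareValues k P Λ π)

end Policies

section Bounds

variable {𝒳 : Type*} [MeasurableSpace 𝒳]

/-- `e_a(x) = ℙ(A = a | X = x)` under the observed-data law. -/
def propensity (P : Measure (Obs 𝒳)) [IsFiniteMeasure P] (a : Bool) (x : 𝒳) : ℝ :=
  (condDistrib (fun z : Obs 𝒳 => z.2.2) (fun z => z.1) P x).real {a}

/-- `F(y | x, a)`, the distribution function of `Y` given `X = x` and `A = a`. -/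
def outcomeCDF (P : Measure (Obs 𝒳)) [IsFiniteMeasure P] (x : 𝒳) (a : Bool) (y : ℝ) : ℝ :=
  (condDistrib (fun z : Obs 𝒳 => z.2.1) (fun z => (z.1, z.2.2)) P (x, a)).real (Set.Iic y)

/-- The quantile `q⁻_Λ(x, a) = inf {q : F(q | x, a) ≥ 1 / (1 + Λ)}`. -/
def lowerQuantile (P : Measure (Obs 𝒳)) [IsFiniteMeasure P] (Λ : ℝ) (x : 𝒳) (a : Bool) : ℝ :=
  sInf {q : ℝ | 1 / (1 + Λ) ≤ outcomeCDF P x a q}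

/-- `sgn t = 1` if `t ≥ 0`, and `-1` otherwise. -/
def sgn (t : ℝ) : ℤ := if 0 ≤ t then 1 else -1

/-- `μ⁻_Λ(x, a) = 𝔼[Y 𝟙{A = a} (1 + (1 - e_a(X)) / e_a(X) * Λ ^ (-sgn (Y - q⁻_Λ(X, a)))) | X = x]`,
the integral against the conditional law of `(Y, A)` given `X = x`. -/
def lowerMean (P : Measure (Obs 𝒳)) [IsFiniteMeasure P] (Λ : ℝ) (x : 𝒳) (a : Bool) : ℝ :=
  ∫ w : ℝ × Bool, w.1 * (if w.2 = a then 1 else 0) *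
      (1 + (1 - propensity P a x) / propensity P a x * Λ ^ (-sgn (w.1 - lowerQuantile P Λ x a)))
    ∂(condDistrib (fun z : Obs 𝒳 => z.2) (fun z => z.1) P x)

/-- The policy `π⋆(x) = 𝟙{μ⁻_Λ(x, 1) - μ⁻_Λ(x, 0) > 0}`. -/
def firstBestPolicy (P : Measure (Obs 𝒳)) [IsFiniteMeasure P] (Λ : ℝ) (x : 𝒳) : ℝ :=
  if lowerMean P Λ x true - lowerMean P Λ x false > 0 then 1 else 0

end Bounds

end MSMPolicy

end

/-! Fix an arm `a` and a law `Q` in the uncertainty set, and let `w` be the odds against `a` given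
`(X, U)`. Conditional independence allows the potential outcomes to be added to the conditioning, so
reweighting arm `a` by `w` reproduces the other arm: `E[T 1{A≠a} | X] = E[T w 1{A=a} | X]` for `T` a
function of `(X, U, Y(1), Y(0))`. With `T = Y(a)` this gives `E[Y(a) | X] = E[Y 1{A=a} (1 + w) |
X]`; with `T = 1` it fixes the conditional mean of `w 1{A=a}`. The sensitivity model confines `w` to
the interval from `Λ⁻¹` to `Λ` times the nominal odds.

Minimizing a linear functional under a box and one moment constraint is a Neyman-Pearson problem:
the weight is `Λ` times nominal below a threshold and `Λ⁻¹` times nominal above it. The moment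
constraint forces mass `1/(1+Λ)` below the threshold, hence the quantile (`condExp_tiltFactor`). The
lower bound is `lowerMean_le_condExp_potential`.

For sharpness, a two-valued confounder marks treated units with high and untreated units with low
outcomes. Bayes' rule gives odds ratios exactly `Λ` and `Λ⁻¹` (`condExp_treatment_worstConfounder`).
Drawing the missing outcome from the other arm given `(X, U)` makes the potential outcomes
independent of treatment while keeping the observed law (`map_crossLaw_eq_compProd`). This one law
attains both bounds, hence the infimum for every policy, and the max-min problem becomes a pointwise
maximization.

Finite means pass from the true law to every `Q` because they are a property of the observed law
alone (`integrable_potential_iff`). -/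

noncomputable section

set_option linter.unusedSectionVars false

namespace MSMPolicy

/-! ### Conditional expectation: tilting, thresholds, conditional independence -/

section Abstract

variable {Ω : Type*} {m mΩ : MeasurableSpace Ω} {μ : Measure Ω}

/-- A nonnegative factor may be replaced by its conditional expectation when it is integrated
against a function that is measurable for the conditioning σ-algebra. -/
lemma lintegral_mul_ofReal_condExp [IsFiniteMeasure μ] (hm : m ≤ mΩ) {b : Ω → ℝ}
    (hb : Integrable b μ) (hb0 : 0 ≤ᵐ[μ] b) {F : Ω → ENNReal} (hF : Measurable[m] F) :
    ∫⁻ x, ENNReal.ofReal (b x) * F x ∂μ = ∫⁻ x, ENNReal.ofReal ((μ[b | m]) x) * F x ∂μ := by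
  have hc0 : 0 ≤ᵐ[μ] μ[b | m] := condExp_nonneg hb0
  have hci : Integrable (μ[b | m]) μ := integrable_condExp
  have hF' : Measurable F := hF.mono hm le_rfl
  have e1 := lintegral_withDensity_eq_lintegral_mul₀ (μ := μ)
    (hb.1.aemeasurable.ennreal_ofReal) hF'.aemeasurable
  have e2 := lintegral_withDensity_eq_lintegral_mul₀ (μ := μ)
    (hci.1.aemeasurable.ennreal_ofReal) hF'.aemeasurable
  simp only [Pi.mul_apply] at e1 e2
  -- An `m`-measurable integrand sees only the trimmed measures, and the densities `b` and `μ[b |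
  -- m]` give the same mass to every set in `m`.
  rw [← e1, ← e2, ← lintegral_trim hm hF, ← lintegral_trim hm hF]
  congr 1
  refine @Measure.ext _ m _ _ fun s hs => ?_
  rw [trim_measurableSet_eq hm hs, trim_measurableSet_eq hm hs, withDensity_apply _ (hm s hs),
    withDensity_apply _ (hm s hs),
    ← ofReal_integral_eq_lintegral_ofReal hb.integrableOn (ae_restrict_of_ae hb0),
    ← ofReal_integral_eq_lintegral_ofReal hci.integrableOn (ae_restrict_of_ae hc0),
    setIntegral_condExp hm hb hs]

/-- Both `T` and `w` are `m`-measurable, so `b` and `c` may be replaced by their conditional means,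
which `w` carries into each other. Stated for `∫⁻`, it presupposes no integrability of the products
and so transfers integrability in both directions. In the application `b` and `c` indicate the two
arms and `w` is the odds. -/
lemma lintegral_enorm_tilt [IsFiniteMeasure μ] (hm : m ≤ mΩ) {b c w T : Ω → ℝ}
    (hb : Integrable b μ) (hb0 : 0 ≤ᵐ[μ] b) (hc : Integrable c μ) (hc0 : 0 ≤ᵐ[μ] c)
    (hw : Measurable[m] w) (hw0 : 0 ≤ᵐ[μ] w) (hT : Measurable[m] T)
    (hbc : μ[b | m] * w =ᵐ[μ] μ[c | m]) :
    ∫⁻ x, ‖T x * w x * b x‖ₑ ∂μ = ∫⁻ x, ‖T x * c x‖ₑ ∂μ := by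
  have h1 : ∫⁻ x, ‖T x * w x * b x‖ₑ ∂μ = ∫⁻ x, ENNReal.ofReal (b x) * ‖T x * w x‖ₑ ∂μ := by
    refine lintegral_congr_ae ?_
    filter_upwards [hb0] with x hx
    rw [enorm_mul, mul_comm, Real.enorm_eq_ofReal hx]
  have h2 : ∫⁻ x, ‖T x * c x‖ₑ ∂μ = ∫⁻ x, ENNReal.ofReal (c x) * ‖T x‖ₑ ∂μ := by
    refine lintegral_congr_ae ?_
    filter_upwards [hc0] with x hx
    rw [enorm_mul, mul_comm, Real.enorm_eq_ofReal hx]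
  rw [h1, h2, lintegral_mul_ofReal_condExp hm hb hb0 (F := fun x => ‖T x * w x‖ₑ)
    (measurable_enorm.comp (hT.mul hw)),
    lintegral_mul_ofReal_condExp hm hc hc0 (F := fun x => ‖T x‖ₑ) (measurable_enorm.comp hT)]
  refine lintegral_congr_ae ?_
  filter_upwards [hbc, hw0, condExp_nonneg (m := m) hb0] with x hx hx0 hx1
  rw [← hx, Pi.mul_apply, enorm_mul, Real.enorm_eq_ofReal hx0, ENNReal.ofReal_mul hx1]
  ring

lemma integrable_tilt_iff [IsFiniteMeasure μ] (hm : m ≤ mΩ) {b c w T : Ω → ℝ}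
    (hb : Integrable b μ) (hb0 : 0 ≤ᵐ[μ] b) (hc : Integrable c μ) (hc0 : 0 ≤ᵐ[μ] c)
    (hw : Measurable[m] w) (hw0 : 0 ≤ᵐ[μ] w) (hT : Measurable[m] T)
    (hbc : μ[b | m] * w =ᵐ[μ] μ[c | m]) :
    Integrable (fun x => T x * w x * b x) μ ↔ Integrable (fun x => T x * c x) μ := by
  have hT' : Measurable T := hT.mono hm le_rfl
  have hw' : Measurable w := hw.mono hm le_rfl
  have key := lintegral_enorm_tilt hm hb hb0 hc hc0 hw hw0 hT hbc
  refine ⟨fun h => ⟨hT'.aestronglyMeasurable.mul hc.1, ?_⟩,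
    fun h => ⟨(hT'.mul hw').aestronglyMeasurable.mul hb.1, ?_⟩⟩
  · rw [hasFiniteIntegral_iff_enorm, ← key]
    exact h.2
  · rw [hasFiniteIntegral_iff_enorm, key]
    exact h.2

lemma condExp_tilt [IsFiniteMeasure μ] (hm : m ≤ mΩ) {b c w T : Ω → ℝ}
    (hb : Integrable b μ) (hb0 : 0 ≤ᵐ[μ] b) (hc : Integrable c μ) (hc0 : 0 ≤ᵐ[μ] c)
    (hw : Measurable[m] w) (hw0 : 0 ≤ᵐ[μ] w) (hT : Measurable[m] T)
    (hbc : μ[b | m] * w =ᵐ[μ] μ[c | m]) (hTc : Integrable (fun x => T x * c x) μ) :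
    μ[fun x => T x * w x * b x | m] =ᵐ[μ] μ[fun x => T x * c x | m] := by
  have hTb := (integrable_tilt_iff hm hb hb0 hc hc0 hw hw0 hT hbc).2 hTc
  have h1 := condExp_mul_of_stronglyMeasurable_left (hT.mul hw).stronglyMeasurable hTb hb
  have h2 := condExp_mul_of_stronglyMeasurable_left hT.stronglyMeasurable hTc hc
  refine h1.trans (.trans ?_ h2.symm)
  filter_upwards [hbc] with x hx
  simp only [Pi.mul_apply] at hx ⊢
  rw [← hx]
  ring

/-- If `D` has zero conditional mean and `T` lies on the side of the threshold `q` given by the sign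
of `D`, then `T * D` has nonnegative conditional mean. -/
lemma condExp_mul_nonneg_of_threshold [IsFiniteMeasure μ] (hm : m ≤ mΩ) {T D q : Ω → ℝ}
    (hq : Measurable[m] q) (hD : Integrable D μ) (hTD : Integrable (fun x => T x * D x) μ)
    (hD0 : μ[D | m] =ᵐ[μ] 0) (hpos : ∀ᵐ x ∂μ, 0 ≤ (T x - q x) * D x) :
    0 ≤ᵐ[μ] μ[fun x => T x * D x | m] := by
  -- `q * D` need not be integrable. The positive `m`-measurable factor `h` makes both `h` and `h *
  -- q` bounded by one, and it is divided out at the end.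
  set h : Ω → ℝ := fun x => (1 + |q x|)⁻¹ with hh
  have habs : Measurable[m] fun x => |q x| := measurable_abs.comp hq
  have hhm : Measurable[m] h := (measurable_const.add habs).inv
  have hh0 : ∀ x, 0 < h x := fun x => by positivity
  have hh1 : ∀ x, ‖h x‖ ≤ 1 := fun x => by
    rw [Real.norm_of_nonneg (hh0 x).le]
    exact inv_le_one_of_one_le₀ (by linarith [abs_nonneg (q x)])
  have hhq : ∀ x, ‖h x * q x‖ ≤ 1 := fun x => by
    rw [norm_mul, Real.norm_of_nonneg (hh0 x).le, Real.norm_eq_abs, hh, inv_mul_le_iff₀ (by positivity)]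
    linarith
  have i1 : Integrable (h * fun x => T x * D x) μ :=
    hTD.bdd_mul (hhm.mono hm le_rfl).aestronglyMeasurable (Filter.Eventually.of_forall hh1)
  have i2 : Integrable ((fun x => h x * q x) * D) μ :=
    hD.bdd_mul ((hhm.mul hq).mono hm le_rfl).aestronglyMeasurable (Filter.Eventually.of_forall hhq)
  have c1 := condExp_mul_of_stronglyMeasurable_left hhm.stronglyMeasurable i1 hTD
  have c2 : μ[(fun x => h x * q x) * D | m] =ᵐ[μ] (fun x => h x * q x) * μ[D | m] :=
    condExp_mul_of_stronglyMeasurable_left (hhm.mul hq).stronglyMeasurable i2 hD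
  have hle : ((fun x => h x * q x) * D) ≤ᵐ[μ] (h * fun x => T x * D x) := by
    filter_upwards [hpos] with x hx
    simp only [Pi.mul_apply]
    nlinarith [mul_nonneg (hh0 x).le hx]
  have hmono := condExp_mono (m := m) i2 i1 hle
  filter_upwards [hmono, c1, c2, hD0] with x hx h1 h2 h3
  simp only [Pi.mul_apply, Pi.zero_apply] at hx h1 h2 h3 ⊢
  rw [h1, h2, h3, mul_zero] at hx
  exact nonneg_of_mul_nonneg_right hx (hh0 x)

/-- Under conditional independence, conditioning also on the other variable does not change the
conditional probabilities. -/
lemma condExp_indicator_prodMk_of_condIndepFun {γ β β' : Type*} [mγ : MeasurableSpace γ]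
    [mβ : MeasurableSpace β] [mβ' : MeasurableSpace β'] [StandardBorelSpace Ω]
    [StandardBorelSpace β] [Nonempty β] [StandardBorelSpace β'] [Nonempty β'] [IsFiniteMeasure μ]
    {k : Ω → γ} {g : Ω → β'} {f : Ω → β} (hk : Measurable k) (hg : Measurable g)
    (hf : Measurable f) (h : CondIndepFun (mγ.comap k) hk.comap_le g f μ)
    {s : Set β} (hs : MeasurableSet s) :
    μ⟦f ⁻¹' s | MeasurableSpace.comap (fun ω => (k ω, g ω)) inferInstance⟧
      =ᵐ[μ] μ⟦f ⁻¹' s | mγ.comap k⟧ := by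
  have h1 := (condIndepFun_iff_condDistrib_prod_ae_eq_prodMkRight hf hg hk).1 h
  have h2 := condDistrib_ae_eq_condExp (μ := μ) (hk.prodMk hg) hf hs
  have h3 := condDistrib_ae_eq_condExp (μ := μ) hk hf hs
  refine h2.symm.trans (.trans ?_ h3)
  filter_upwards [ae_of_ae_map (hk.prodMk hg).aemeasurable h1] with x hx
  simp only [hx, Kernel.prodMkRight_apply]

/-- A variable whose joint law with `(k, g)` is governed by a kernel of `k` alone is conditionally
independent of `g` given `k`. -/
lemma condIndepFun_of_map_eq_compProd_prodMkRight {γ β β' : Type*} [mγ : MeasurableSpace γ]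
    [mβ : MeasurableSpace β] [mβ' : MeasurableSpace β'] [StandardBorelSpace Ω]
    [StandardBorelSpace β] [Nonempty β] [StandardBorelSpace β'] [Nonempty β'] [IsFiniteMeasure μ]
    {k : Ω → γ} {g : Ω → β'} {f : Ω → β} (hk : Measurable k) (hg : Measurable g)
    (hf : Measurable f) (ζ : Kernel γ β) [IsMarkovKernel ζ]
    (h : μ.map (fun ω => ((k ω, g ω), f ω)) =
      μ.map (fun ω => (k ω, g ω)) ⊗ₘ ζ.prodMkRight β') :
    CondIndepFun (mγ.comap k) hk.comap_le g f μ := by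
  rw [condIndepFun_iff_condDistrib_prod_ae_eq_prodMkRight hf hg hk]
  have h1 := condDistrib_ae_eq_of_measure_eq_compProd _ hf.aemeasurable h
  -- Since `ζ` ignores `g`, integrating `g` out leaves `ζ` as the conditional law of `f` given `k`
  -- alone.
  have h2 : μ.map (fun ω => (k ω, f ω)) = μ.map k ⊗ₘ ζ := by
    have e : μ.map (fun ω => (k ω, f ω)) =
        (μ.map (fun ω => ((k ω, g ω), f ω))).map (fun z => (z.1.1, z.2)) := by
      rw [Measure.map_map (by fun_prop) (by fun_prop)]; rfl
    rw [e, h]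
    refine Measure.ext_of_lintegral _ fun F hF => ?_
    rw [lintegral_map hF (by fun_prop), Measure.lintegral_compProd (by fun_prop),
      Measure.lintegral_compProd hF, lintegral_map _ (by fun_prop), lintegral_map _ (by fun_prop)]
    · simp [Kernel.prodMkRight_apply]
    · exact hF.lintegral_kernel_prod_right'
    · exact Measurable.lintegral_kernel_prod_right' (κ := ζ.prodMkRight β')
        (f := fun z : (γ × β') × β => F (z.1.1, z.2)) (by fun_prop)
  have h3 := condDistrib_ae_eq_of_measure_eq_compProd _ hf.aemeasurable h2
  have h4 : μ.map k = (μ.map (fun ω => (k ω, g ω))).map Prod.fst := by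
    rw [Measure.map_map (by fun_prop) (by fun_prop)]; rfl
  rw [h4] at h3
  filter_upwards [h1, ae_of_ae_map (by fun_prop) h3] with x hx hx3
  rw [hx, Kernel.prodMkRight_apply, Kernel.prodMkRight_apply, hx3]

/-- Conditional expectations given a random variable are transported along measurable maps. -/
lemma condExp_map_comp {α γ : Type*} [MeasurableSpace α] [mγ : MeasurableSpace γ]
    [IsFiniteMeasure μ] {φ : Ω → α} (hφ : Measurable φ) {h : α → γ} (hh : Measurable h) {g : α → ℝ}
    (hg : Integrable g (μ.map φ)) :
    (μ.map φ)[g | mγ.comap h] ∘ φ =ᵐ[μ] μ[g ∘ φ | mγ.comap (h ∘ φ)] := by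
  have hc : Integrable ((μ.map φ)[g | mγ.comap h]) (μ.map φ) := integrable_condExp
  have hcm : StronglyMeasurable[mγ.comap h] ((μ.map φ)[g | mγ.comap h]) :=
    stronglyMeasurable_condExp
  refine ae_eq_condExp_of_forall_setIntegral_eq (hh.comp hφ).comap_le
    (hg.comp_measurable hφ) (fun s _ _ => (hc.comp_measurable hφ).integrableOn) ?_ ?_
  · rintro _ ⟨t, ht, rfl⟩ -
    have e1 := setIntegral_map (hh ht) hc.1 hφ.aemeasurable
    have e2 := setIntegral_map (hh ht) hg.1 hφ.aemeasurable
    rw [setIntegral_condExp hh.comap_le hg ⟨t, ht, rfl⟩, e2] at e1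
    exact e1.symm
  · have hφ' : Measurable[mγ.comap (h ∘ φ), mγ.comap h] φ := by
      rintro _ ⟨t, ht, rfl⟩
      exact ⟨t, ht, rfl⟩
    exact (hcm.comp_measurable hφ').aestronglyMeasurable

end Abstract

/-! ### Quantiles of a probability measure on the line -/

section Quantile

open Filter Topology Set

variable (ν : Measure ℝ) [IsProbabilityMeasure ν] {p : ℝ}

lemma nonempty_setOf_le_measureReal_Iic (hp : p < 1) : {t : ℝ | p ≤ ν.real (Iic t)}.Nonempty := by
  have h := tendsto_cdf_atTop ν
  obtain ⟨t, ht⟩ := (h.eventually (lt_mem_nhds hp)).exists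
  exact ⟨t, by simpa [cdf_eq_real] using ht.le⟩

lemma bddBelow_setOf_le_measureReal_Iic (hp : 0 < p) : BddBelow {t : ℝ | p ≤ ν.real (Iic t)} := by
  have h := tendsto_cdf_atBot ν
  obtain ⟨t, ht⟩ := (h.eventually (gt_mem_nhds hp)).exists
  refine ⟨t, fun s hs => ?_⟩
  by_contra! hlt
  have h1 := monotone_cdf ν hlt.le
  simp only [cdf_eq_real] at h1 ht
  exact absurd (hs.trans h1) (not_le.2 ht)

/-- Right continuity of the distribution function makes the infimum attained. The equivalence also
reduces measurability of a conditional quantile to that of the conditional distribution function. -/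
lemma sInf_setOf_le_measureReal_Iic_le_iff (hp0 : 0 < p) (hp1 : p < 1) (t : ℝ) :
    sInf {t : ℝ | p ≤ ν.real (Iic t)} ≤ t ↔ p ≤ ν.real (Iic t) := by
  refine ⟨fun h => ?_, fun h => csInf_le (bddBelow_setOf_le_measureReal_Iic ν hp0) h⟩
  have hc : ContinuousWithinAt (cdf ν) (Ioi t) t :=
    ((cdf ν).right_continuous t).mono Ioi_subset_Ici_self
  rw [← cdf_eq_real]
  refine ge_of_tendsto hc.tendsto (eventually_nhdsWithin_of_forall fun s hs => ?_)
  obtain ⟨r, hr, hrs⟩ := exists_lt_of_csInf_lt (nonempty_setOf_le_measureReal_Iic ν hp1)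
    (lt_of_le_of_lt h hs)
  have := monotone_cdf ν hrs.le
  rw [cdf_eq_real] at this
  exact (show p ≤ _ from hr).trans this

/-- Without an atom at the `p`-quantile, exactly the mass `p` lies below it. -/
lemma measureReal_Iio_sInf_setOf_le_measureReal_Iic (hp0 : 0 < p) (hp1 : p < 1)
    (h : ν {sInf {t : ℝ | p ≤ ν.real (Iic t)}} = 0) :
    ν.real (Iio (sInf {t : ℝ | p ≤ ν.real (Iic t)})) = p := by
  set q := sInf {t : ℝ | p ≤ ν.real (Iic t)} with hq
  apply le_antisymm
  · have h1 : ν (Iio q) = ENNReal.ofReal (Function.leftLim (cdf ν) q) := by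
      have := (cdf ν).measure_Iio (tendsto_cdf_atBot ν) q
      rwa [measure_cdf, sub_zero] at this
    -- Every `s < q` has distribution function below `p`, so the left limit is at most `p`.
    have h2 : Function.leftLim (cdf ν) q ≤ p := by
      refine le_of_tendsto ((monotone_cdf ν).tendsto_leftLim q)
        (eventually_nhdsWithin_of_forall fun s hs => ?_)
      by_contra! hlt
      rw [cdf_eq_real] at hlt
      exact absurd ((sInf_setOf_le_measureReal_Iic_le_iff ν hp0 hp1 s).2 hlt.le) (not_le.2 hs)
    rw [measureReal_def, h1]
    exact ENNReal.toReal_le_of_le_ofReal hp0.le (ENNReal.ofReal_le_ofReal h2)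
  · have h1 : p ≤ ν.real (Iic q) := (sInf_setOf_le_measureReal_Iic_le_iff ν hp0 hp1 q).1 le_rfl
    have h2 : ν (Iic q) ≤ ν (Iio q) := by
      rw [← Iio_union_right]
      exact (measure_union_le _ _).trans (by rw [h, add_zero])
    exact h1.trans (ENNReal.toReal_mono (measure_ne_top _ _) h2)

lemma integral_ite_lt (q α β : ℝ) :
    ∫ y, (if y < q then α else β) ∂ν = α * ν.real (Iio q) + β * (1 - ν.real (Iio q)) := by
  have h : (fun y => if y < q then α else β) = fun y => (Iio q).indicator (fun _ => α - β) y + β := by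
    funext y
    by_cases hy : y < q <;> simp [hy]
  rw [h, integral_add ((integrable_const _).indicator measurableSet_Iio) (integrable_const _),
    integral_indicator_const _ measurableSet_Iio]
  simp
  ring

end Quantile

/-! ### Odds for and against an arm -/

open Full

attribute [fun_prop] measurable_Y1 measurable_Y0 measurable_X measurable_A measurable_U

/-- The probability of arm `a` when the probability of arm `true` is `p`. -/
def armProb (a : Bool) (p : ℝ) : ℝ := if a then p else 1 - p

/-- The odds against arm `a` when the probability of arm `true` is `p`. -/
def oddsAgainst (a : Bool) (p : ℝ) : ℝ := armProb (!a) p / armProb a p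

lemma armProb_not (a : Bool) (p : ℝ) : armProb (!a) p = 1 - armProb a p := by
  cases a <;> simp [armProb]

lemma measurable_armProb (a : Bool) : Measurable (armProb a) := by
  unfold armProb
  cases a <;> simp <;> fun_prop

lemma measurable_oddsAgainst (a : Bool) : Measurable (oddsAgainst a) :=
  (measurable_armProb _).div (measurable_armProb _)

lemma oddsAgainst_nonneg {p : ℝ} (h0 : 0 ≤ p) (h1 : p ≤ 1) (a : Bool) : 0 ≤ oddsAgainst a p := by
  cases a
  · exact div_nonneg h0 (sub_nonneg.2 h1)
  · exact div_nonneg (sub_nonneg.2 h1) h0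

/-- At `p = 1` the odds are `1 / 0`, which is zero by convention, so both endpoints have zero odds.
-/
lemma pos_lt_one_of_odds_pos {p : ℝ} (h0 : 0 ≤ p) (h1 : p ≤ 1) (h : odds p ≠ 0) :
    0 < p ∧ p < 1 := by
  refine ⟨lt_of_le_of_ne h0 fun h' => h ?_, lt_of_le_of_ne h1 fun h' => h ?_⟩
  · simp [odds, ← h']
  · simp [odds, h']

lemma oddsAgainst_false (p : ℝ) : oddsAgainst false p = odds p := rfl

lemma oddsAgainst_true (p : ℝ) : oddsAgainst true p = (odds p)⁻¹ := by
  simp [oddsAgainst, armProb, odds]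

lemma odds_pos {p : ℝ} (h0 : 0 < p) (h1 : p < 1) : 0 < odds p := div_pos h0 (sub_pos.2 h1)

/-- A positive lower bound on the ratio excludes the degenerate scores. The interval from `1/Λ` to
`Λ` is stable under inversion, so the same box serves the odds against treatment and the odds
against control. -/
lemma oddsAgainst_le_of_odds_ratio {Λ p e : ℝ} (hΛ : 1 ≤ Λ) (hp0 : 0 ≤ p) (hp1 : p ≤ 1)
    (he0 : 0 ≤ e) (he1 : e ≤ 1) (hl : 1 / Λ ≤ odds p / odds e) (hu : odds p / odds e ≤ Λ) :
    (0 < p ∧ p < 1) ∧ (0 < e ∧ e < 1) ∧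
      ∀ a, oddsAgainst a p ≤ Λ * oddsAgainst a e ∧ oddsAgainst a e ≤ Λ * oddsAgainst a p := by
  have hΛ0 : 0 < Λ := by linarith
  have hpos : 0 < odds p / odds e := lt_of_lt_of_le (by positivity) hl
  have hp := pos_lt_one_of_odds_pos hp0 hp1 fun h => by simp [h] at hpos
  have he := pos_lt_one_of_odds_pos he0 he1 fun h => by simp [h] at hpos
  have hop := odds_pos hp.1 hp.2
  have hoe := odds_pos he.1 he.2
  rw [div_le_iff₀ hoe] at hu
  rw [div_le_div_iff₀ hΛ0 hoe, one_mul] at hl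
  refine ⟨hp, he, fun a => ?_⟩
  cases a
  · simp only [oddsAgainst_false]
    exact ⟨hu, by linarith⟩
  · simp only [oddsAgainst_true]
    rw [inv_le_iff_one_le_mul₀ hop, inv_le_iff_one_le_mul₀ hoe, mul_assoc, mul_assoc,
      ← mul_le_mul_iff_right₀ hoe, ← mul_le_mul_iff_right₀ hop]
    constructor
    · field_simp
      linarith
    · field_simp
      linarith

/-! ### Treatment arms and reweighting under the sensitivity model -/

section

variable {𝒳 : Type*} {k : ℕ}

/-- The indicator of treatment arm `a`. -/
def arm (a : Bool) (o : Full 𝒳 k) : ℝ := if A o = a then 1 else 0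

lemma arm_nonneg (a : Bool) (o : Full 𝒳 k) : 0 ≤ arm a o := by
  unfold arm; split_ifs <;> norm_num

lemma arm_le_one (a : Bool) (o : Full 𝒳 k) : arm a o ≤ 1 := by
  unfold arm; split_ifs <;> norm_num

lemma arm_add_arm_not (a : Bool) (o : Full 𝒳 k) : arm a o + arm (!a) o = 1 := by
  unfold arm
  cases a <;> cases A o <;> simp

lemma arm_eq_indicator (a : Bool) :
    (arm a : Full 𝒳 k → ℝ) = (A ⁻¹' {a}).indicator (fun _ => (1 : ℝ)) := by
  funext o
  by_cases h : A o = a <;> simp [arm, Set.indicator, h]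

variable [MeasurableSpace 𝒳]

@[fun_prop]
lemma measurable_arm (a : Bool) : Measurable (arm a : Full 𝒳 k → ℝ) := by
  rw [arm_eq_indicator]
  exact measurable_const.indicator (measurable_A (measurableSet_singleton a))

@[fun_prop]
lemma measurable_potential (a : Bool) : Measurable (potential a : Full 𝒳 k → ℝ) := by
  cases a
  · exact measurable_Y0
  · exact measurable_Y1

@[fun_prop]
lemma measurable_observed : Measurable (observed : Full 𝒳 k → Obs 𝒳) := by
  have h : (fun o : Full 𝒳 k => potential (A o) o) =
      fun o => if A o = true then Y1 o else Y0 o := by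
    funext o
    simp [potential]
  have h2 : Measurable fun o : Full 𝒳 k => potential (A o) o := by
    rw [h]
    exact Measurable.ite (measurable_A (measurableSet_singleton true)) measurable_Y1 measurable_Y0
  exact measurable_X.prodMk (h2.prodMk measurable_A)

lemma integrable_arm (a : Bool) (Q : Measure (Full 𝒳 k)) [IsFiniteMeasure Q] :
    Integrable (arm a) Q :=
  Integrable.of_bound (measurable_arm a).aestronglyMeasurable 1
    (Filter.Eventually.of_forall fun o => by
      rw [Real.norm_of_nonneg (arm_nonneg a o)]; exact arm_le_one a o)

/-- The σ-algebra generated by the covariates, the confounders and the potential outcomes. -/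
abbrev sigmaXUY (𝒳 : Type*) [MeasurableSpace 𝒳] (k : ℕ) : MeasurableSpace (Full 𝒳 k) :=
  MeasurableSpace.comap (fun o => ((X o, U o), (Y1 o, Y0 o))) inferInstance

lemma sigmaXUY_le : sigmaXUY 𝒳 k ≤ (inferInstance : MeasurableSpace (Full 𝒳 k)) :=
  Measurable.comap_le (by fun_prop)

lemma sigmaXU_le_sigmaXUY : sigmaXU 𝒳 k ≤ sigmaXUY 𝒳 k := by
  rintro _ ⟨s, hs, rfl⟩
  exact ⟨Prod.fst ⁻¹' s, measurable_fst hs, rfl⟩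

lemma sigmaX_le_sigmaXU : sigmaX 𝒳 k ≤ sigmaXU 𝒳 k := by
  rintro _ ⟨s, hs, rfl⟩
  exact ⟨Prod.fst ⁻¹' s, measurable_fst hs, rfl⟩

lemma measurable_potential_sigmaXUY (a : Bool) :
    Measurable[sigmaXUY 𝒳 k] (potential a : Full 𝒳 k → ℝ) := by
  have h : Measurable[sigmaXUY 𝒳 k] fun o : Full 𝒳 k => ((X o, U o), (Y1 o, Y0 o)) :=
    comap_measurable _
  cases a
  · exact (measurable_snd.comp measurable_snd).comp h
  · exact (measurable_fst.comp measurable_snd).comp h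

variable [StandardBorelSpace 𝒳]

section Propensity

variable (P : Measure (Obs 𝒳)) [IsProbabilityMeasure P]

lemma propensity_nonneg (a : Bool) (x : 𝒳) : 0 ≤ propensity P a x := measureReal_nonneg

lemma propensity_le_one (a : Bool) (x : 𝒳) : propensity P a x ≤ 1 := measureReal_le_one

lemma propensity_eq_armProb (a : Bool) (x : 𝒳) :
    propensity P a x = armProb a (propensity P true x) := by
  cases a
  · have h := probReal_compl_eq_one_sub (μ := condDistrib (fun z : Obs 𝒳 => z.2.2)
      (fun z => z.1) P x) (measurableSet_singleton true)
    have h2 : ({true}ᶜ : Set Bool) = {false} := by ext b; cases b <;> simp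
    rw [h2] at h
    simpa [armProb, propensity] using h
  · simp [armProb]

lemma odds_propensity (a : Bool) (x : 𝒳) :
    (1 - propensity P a x) / propensity P a x = oddsAgainst a (propensity P true x) := by
  rw [propensity_eq_armProb P a x, oddsAgainst, armProb_not]

@[fun_prop]
lemma measurable_propensity (a : Bool) : Measurable (propensity P a) :=
  (Kernel.measurable_coe _ (measurableSet_singleton a)).ennreal_toReal

end Propensity

variable {Q : Measure (Full 𝒳 k)} [IsProbabilityMeasure Q] {P : Measure (Obs 𝒳)}
  [IsProbabilityMeasure P] {Λ : ℝ}

/-- `condDistrib` is built from the joint law only, so the two kernels coincide everywhere and not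
just almost everywhere. -/
lemma condDistrib_observed {α β : Type*} [MeasurableSpace α] [MeasurableSpace β]
    [StandardBorelSpace β] [Nonempty β] (hP : Q.map observed = P) {f : Obs 𝒳 → α} {g : Obs 𝒳 → β}
    (hf : Measurable f) (hg : Measurable g) :
    condDistrib g f P = condDistrib (g ∘ observed) (f ∘ observed) Q := by
  have h : P.map (fun z => (f z, g z)) =
      Q.map (fun o => ((f ∘ observed) o, (g ∘ observed) o)) := by
    rw [← hP, Measure.map_map (by fun_prop) (by fun_prop)]
    rfl
  simp only [condDistrib, h]

lemma ae_of_ae_observed (hP : Q.map observed = P) {p : Obs 𝒳 → Prop} (h : ∀ᵐ z ∂P, p z) :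
    ∀ᵐ o ∂Q, p (observed o) :=
  ae_of_ae_map measurable_observed.aemeasurable (hP ▸ h)

lemma condExp_arm_sigmaX (hP : Q.map observed = P) (a : Bool) :
    Q[arm a | sigmaX 𝒳 k] =ᵐ[Q] fun o => propensity P a (X o) := by
  have h := condDistrib_ae_eq_condExp (μ := Q) measurable_X measurable_A
    (measurableSet_singleton a)
  rw [arm_eq_indicator]
  refine h.symm.trans (Filter.Eventually.of_forall fun o => ?_)
  unfold propensity
  rw [condDistrib_observed hP measurable_fst (by fun_prop)]
  rfl

lemma nominalPropensity_ae_eq (hP : Q.map observed = P) :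
    nominalPropensity Q =ᵐ[Q] fun o => propensity P true (X o) := by
  have h := condExp_arm_sigmaX hP true
  rwa [arm_eq_indicator] at h

lemma truePropensity_mem_Icc : ∀ᵐ o ∂Q, 0 ≤ truePropensity Q o ∧ truePropensity Q o ≤ 1 := by
  have hi : Integrable ((A ⁻¹' {true}).indicator (fun _ => (1 : ℝ))) Q := by
    rw [← arm_eq_indicator]; exact integrable_arm _ _
  have h0 : 0 ≤ᵐ[Q] truePropensity Q := condExp_nonneg
    (Filter.Eventually.of_forall (by rw [← arm_eq_indicator]; exact arm_nonneg true))
  have h1 := condExp_mono (m := sigmaXU 𝒳 k) hi (integrable_const (1 : ℝ))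
    (Filter.Eventually.of_forall (by rw [← arm_eq_indicator]; exact arm_le_one true))
  rw [condExp_const sigmaXU_le] at h1
  filter_upwards [h0, h1] with o h h' using ⟨h, h'⟩

lemma propensities_of_marginalSensitivity (hΛ : 1 ≤ Λ) (hQ : MarginalSensitivity Λ Q)
    (hP : Q.map observed = P) : ∀ᵐ o ∂Q,
      (0 < truePropensity Q o ∧ truePropensity Q o < 1) ∧
      (0 < propensity P true (X o) ∧ propensity P true (X o) < 1) ∧
      ∀ a, oddsAgainst a (truePropensity Q o) ≤ Λ * oddsAgainst a (propensity P true (X o)) ∧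
        oddsAgainst a (propensity P true (X o)) ≤ Λ * oddsAgainst a (truePropensity Q o) := by
  filter_upwards [hQ.lower, hQ.upper, nominalPropensity_ae_eq hP, truePropensity_mem_Icc (Q := Q)]
    with o h1 h2 h3 h4
  rw [h3] at h1 h2
  exact oddsAgainst_le_of_odds_ratio hΛ h4.1 h4.2 (propensity_nonneg P _ _)
    (propensity_le_one P _ _) h1 h2

/-- This is where the independence of treatment and potential outcomes given `(X, U)` enters the
bound: the propensity is unchanged when the outcomes join the conditioning. -/
lemma condExp_arm_sigmaXUY (hQ : MarginalSensitivity Λ Q) (a : Bool) :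
    Q[arm a | sigmaXUY 𝒳 k] =ᵐ[Q] fun o => armProb a (truePropensity Q o) := by
  have h := condExp_indicator_prodMk_of_condIndepFun (measurable_X.prodMk measurable_U)
    (measurable_Y1.prodMk measurable_Y0) measurable_A hQ.condIndep (measurableSet_singleton true)
  cases a
  · have e : (arm false : Full 𝒳 k → ℝ) = (fun _ => 1) - arm true := by
      funext o
      have := arm_add_arm_not true o
      simp only [Bool.not_true, Pi.sub_apply] at this ⊢
      linarith
    rw [e]
    refine (condExp_sub (integrable_const _) (integrable_arm _ _) _).trans ?_
    rw [condExp_const sigmaXUY_le, arm_eq_indicator]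
    filter_upwards [h] with o ho
    simp only [Pi.sub_apply, ho, armProb]
    rfl
  · rw [arm_eq_indicator]
    exact h

/-- The odds against arm `a` given covariates and confounders. -/
def trueOddsAgainst (Q : Measure (Full 𝒳 k)) (a : Bool) (o : Full 𝒳 k) : ℝ :=
  oddsAgainst a (truePropensity Q o)

lemma measurable_trueOddsAgainst (Q : Measure (Full 𝒳 k)) (a : Bool) :
    Measurable[sigmaXUY 𝒳 k] (trueOddsAgainst Q a) :=
  (measurable_oddsAgainst a).comp
    ((stronglyMeasurable_condExp (m := sigmaXU 𝒳 k)).measurable.mono sigmaXU_le_sigmaXUY le_rfl)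

lemma trueOddsAgainst_nonneg (a : Bool) : 0 ≤ᵐ[Q] trueOddsAgainst Q a := by
  filter_upwards [truePropensity_mem_Icc (Q := Q)] with o ho using oddsAgainst_nonneg ho.1 ho.2 a

lemma condExp_arm_mul_trueOddsAgainst (hΛ : 1 ≤ Λ) (hQ : MarginalSensitivity Λ Q)
    (hP : Q.map observed = P) (a : Bool) :
    Q[arm a | sigmaXUY 𝒳 k] * trueOddsAgainst Q a =ᵐ[Q] Q[arm (!a) | sigmaXUY 𝒳 k] := by
  filter_upwards [condExp_arm_sigmaXUY hQ a, condExp_arm_sigmaXUY hQ (!a),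
    propensities_of_marginalSensitivity hΛ hQ hP] with o h1 h2 h3
  rw [Pi.mul_apply, h1, h2, trueOddsAgainst, oddsAgainst, mul_div_cancel₀]
  cases a
  · exact (sub_pos.2 h3.1.2).ne'
  · exact h3.1.1.ne'

lemma integrable_mul_trueOddsAgainst_iff (hΛ : 1 ≤ Λ) (hQ : MarginalSensitivity Λ Q)
    (hP : Q.map observed = P) (a : Bool) {T : Full 𝒳 k → ℝ} (hT : Measurable[sigmaXUY 𝒳 k] T) :
    Integrable (fun o => T o * trueOddsAgainst Q a o * arm a o) Q ↔
      Integrable (fun o => T o * arm (!a) o) Q :=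
  integrable_tilt_iff sigmaXUY_le (integrable_arm a Q)
    (Filter.Eventually.of_forall (arm_nonneg a)) (integrable_arm _ Q)
    (Filter.Eventually.of_forall (arm_nonneg _)) (measurable_trueOddsAgainst Q a)
    (trueOddsAgainst_nonneg a) hT (condExp_arm_mul_trueOddsAgainst hΛ hQ hP a)

/-- Given the covariates, the counterfactual part of a potential outcome has the same mean as the
factual part reweighted by the odds against treatment. -/
lemma condExp_mul_trueOddsAgainst (hΛ : 1 ≤ Λ) (hQ : MarginalSensitivity Λ Q)
    (hP : Q.map observed = P) (a : Bool) {T : Full 𝒳 k → ℝ} (hT : Measurable[sigmaXUY 𝒳 k] T)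
    (hTi : Integrable (fun o => T o * arm (!a) o) Q) :
    Q[fun o => T o * trueOddsAgainst Q a o * arm a o | sigmaX 𝒳 k] =ᵐ[Q]
      Q[fun o => T o * arm (!a) o | sigmaX 𝒳 k] := by
  have h := condExp_tilt sigmaXUY_le (integrable_arm a Q)
    (Filter.Eventually.of_forall (arm_nonneg a)) (integrable_arm _ Q)
    (Filter.Eventually.of_forall (arm_nonneg _)) (measurable_trueOddsAgainst Q a)
    (trueOddsAgainst_nonneg a) hT (condExp_arm_mul_trueOddsAgainst hΛ hQ hP a) hTi
  have hle : sigmaX 𝒳 k ≤ sigmaXUY 𝒳 k := sigmaX_le_sigmaXU.trans sigmaXU_le_sigmaXUY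
  exact (condExp_condExp_of_le hle sigmaXUY_le).symm.trans
    ((condExp_congr_ae h).trans (condExp_condExp_of_le hle sigmaXUY_le))

end

variable {𝒳 : Type*} [MeasurableSpace 𝒳] [StandardBorelSpace 𝒳] {k : ℕ}

/-! ### The quantile and the tilting factor -/

section Weights

variable (P : Measure (Obs 𝒳)) [IsProbabilityMeasure P] (Λ : ℝ)

lemma quantileLevel_pos (hΛ : 1 ≤ Λ) : 0 < 1 / (1 + Λ) := by positivity

lemma quantileLevel_lt_one (hΛ : 1 ≤ Λ) : 1 / (1 + Λ) < 1 := by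
  rw [div_lt_one (by linarith)]; linarith

lemma measurable_lowerQuantile (hΛ : 1 ≤ Λ) :
    Measurable (fun w : 𝒳 × Bool => lowerQuantile P Λ w.1 w.2) := by
  refine measurable_of_Iic fun t => ?_
  have h : (fun w : 𝒳 × Bool => lowerQuantile P Λ w.1 w.2) ⁻¹' Set.Iic t =
      {w | 1 / (1 + Λ) ≤ (condDistrib (fun z : Obs 𝒳 => z.2.1) (fun z => (z.1, z.2.2)) P w).real
        (Set.Iic t)} := by
    ext w
    exact sInf_setOf_le_measureReal_Iic_le_iff _ (quantileLevel_pos Λ hΛ)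
      (quantileLevel_lt_one Λ hΛ) t
  rw [h]
  exact measurableSet_le measurable_const
    (Kernel.measurable_coe _ measurableSet_Iic).ennreal_toReal

/-- The factor `Λ ^ (-sgn (y - q⁻(x, a)))`. -/
def tiltFactor (x : 𝒳) (a : Bool) (y : ℝ) : ℝ := Λ ^ (-sgn (y - lowerQuantile P Λ x a))

lemma tiltFactor_eq (x : 𝒳) (a : Bool) (y : ℝ) :
    tiltFactor P Λ x a y = if y < lowerQuantile P Λ x a then Λ else Λ⁻¹ := by
  unfold tiltFactor sgn
  by_cases h : y < lowerQuantile P Λ x a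
  · simp [h, not_le.2 h]
  · simp [h, not_lt.1 h]

lemma tiltFactor_pos (hΛ : 1 ≤ Λ) (x : 𝒳) (a : Bool) (y : ℝ) : 0 < tiltFactor P Λ x a y :=
  zpow_pos (by linarith) _

lemma tiltFactor_le (hΛ : 1 ≤ Λ) (x : 𝒳) (a : Bool) (y : ℝ) : tiltFactor P Λ x a y ≤ Λ := by
  rw [tiltFactor_eq]
  split_ifs
  · exact le_rfl
  · exact (inv_le_one_of_one_le₀ hΛ).trans hΛ

lemma measurable_tiltFactor (hΛ : 1 ≤ Λ) {α : Type*} [MeasurableSpace α] {x : α → 𝒳} {a : α → Bool}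
    {y : α → ℝ} (hx : Measurable x) (ha : Measurable a) (hy : Measurable y) :
    Measurable fun t => tiltFactor P Λ (x t) (a t) (y t) := by
  have hq : Measurable fun t => lowerQuantile P Λ (x t) (a t) :=
    Measurable.comp (g := fun w : 𝒳 × Bool => lowerQuantile P Λ w.1 w.2)
      (f := fun t => (x t, a t)) (measurable_lowerQuantile P Λ hΛ) (hx.prodMk ha)
  simp only [tiltFactor_eq]
  exact Measurable.ite (measurableSet_lt hy hq) measurable_const measurable_const

/-- The integrand that defines `lowerMean`. -/
def lowerIntegrand (a : Bool) (x : 𝒳) (w : ℝ × Bool) : ℝ :=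
  w.1 * (if w.2 = a then 1 else 0) *
    (1 + (1 - propensity P a x) / propensity P a x * tiltFactor P Λ x a w.1)

lemma measurable_lowerIntegrand (hΛ : 1 ≤ Λ) (a : Bool) :
    Measurable fun z : Obs 𝒳 => lowerIntegrand P Λ a z.1 z.2 := by
  unfold lowerIntegrand
  have h1 : Measurable fun z : Obs 𝒳 => (if z.2.2 = a then (1 : ℝ) else 0) :=
    Measurable.ite ((measurable_snd.comp measurable_snd) (measurableSet_singleton a))
      measurable_const measurable_const
  have h2 := measurable_tiltFactor P Λ hΛ (measurable_fst : Measurable fun z : Obs 𝒳 => z.1)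
    (measurable_const (a := a)) (measurable_fst.comp measurable_snd)
  have h3 : Measurable fun z : Obs 𝒳 => propensity P a z.1 := by fun_prop
  exact ((measurable_fst.comp measurable_snd).mul h1).mul
    (measurable_const.add (((measurable_const.sub h3).div h3).mul h2))

lemma lowerMean_eq (a : Bool) (x : 𝒳) : lowerMean P Λ x a =
    ∫ w, lowerIntegrand P Λ a x w ∂(condDistrib (fun z : Obs 𝒳 => z.2) (fun z => z.1) P x) := rfl

lemma measurable_lowerMean (hΛ : 1 ≤ Λ) (a : Bool) : Measurable fun x => lowerMean P Λ x a :=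
  (StronglyMeasurable.integral_condDistrib
    (measurable_lowerIntegrand P Λ hΛ a).stronglyMeasurable).measurable

/-- The law of `Y` given `(X, A)` puts mass `1 / (1 + Λ)` below the quantile. -/
lemma measureReal_Iio_lowerQuantile (hΛ : 1 ≤ Λ)
    (hatom : P {z | z.2.1 = lowerQuantile P Λ z.1 z.2.2} = 0) :
    ∀ᵐ z ∂P, (condDistrib (fun z : Obs 𝒳 => z.2.1) (fun z => (z.1, z.2.2)) P (z.1, z.2.2)).real
      (Set.Iio (lowerQuantile P Λ z.1 z.2.2)) = 1 / (1 + Λ) := by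
  set κ := condDistrib (fun z : Obs 𝒳 => z.2.1) (fun z => (z.1, z.2.2)) P with hκ
  have hq := measurable_lowerQuantile P Λ hΛ
  have hS : MeasurableSet {w : (𝒳 × Bool) × ℝ | w.2 = lowerQuantile P Λ w.1.1 w.1.2} :=
    measurableSet_eq_fun measurable_snd (hq.comp measurable_fst)
  -- The null event disintegrates along the law of `(X, A)`, so almost every conditional law has no
  -- atom at its own quantile.
  have h1 : (P.map (fun z : Obs 𝒳 => (z.1, z.2.2)) ⊗ₘ κ)
      {w : (𝒳 × Bool) × ℝ | w.2 = lowerQuantile P Λ w.1.1 w.1.2} = 0 := by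
    rw [compProd_map_condDistrib (by fun_prop), Measure.map_apply (by fun_prop) hS]
    exact hatom
  rw [Measure.compProd_apply hS, lintegral_eq_zero_iff (Kernel.measurable_kernel_prodMk_left hS)]
    at h1
  filter_upwards [ae_of_ae_map (by fun_prop) h1] with z hz
  exact measureReal_Iio_sInf_setOf_le_measureReal_Iic _ (quantileLevel_pos Λ hΛ)
    (quantileLevel_lt_one Λ hΛ) hz

/-- The level `1/(1+Λ)` is made for this: `Λ · 1/(1+Λ) + Λ⁻¹ · Λ/(1+Λ) = 1`. For `Λ = 1` the factor
is constantly one and atoms do not matter. -/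
lemma condExp_tiltFactor (hΛ : 1 ≤ Λ)
    (hatom : 1 < Λ → P {z | z.2.1 = lowerQuantile P Λ z.1 z.2.2} = 0) :
    P[fun z => tiltFactor P Λ z.1 z.2.2 z.2.1 |
      MeasurableSpace.comap (fun z : Obs 𝒳 => (z.1, z.2.2)) inferInstance] =ᵐ[P] fun _ => 1 := by
  have hX : Measurable fun z : Obs 𝒳 => (z.1, z.2.2) := by fun_prop
  rcases hΛ.eq_or_lt with h | h
  · subst h
    have e : (fun z : Obs 𝒳 => tiltFactor P 1 z.1 z.2.2 z.2.1) = fun _ => 1 := by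
      funext z; simp [tiltFactor]
    rw [e, condExp_const hX.comap_le]
  · have hm : Measurable fun w : (𝒳 × Bool) × ℝ => tiltFactor P Λ w.1.1 w.1.2 w.2 :=
      measurable_tiltFactor P Λ hΛ (by fun_prop) (by fun_prop) (by fun_prop)
    have hY : Measurable fun z : Obs 𝒳 => z.2.1 := by fun_prop
    have hi : Integrable (fun z : Obs 𝒳 => tiltFactor P Λ z.1 z.2.2 z.2.1) P :=
      Integrable.of_bound (hm.comp (hX.prodMk hY)).aestronglyMeasurable Λ
        (Filter.Eventually.of_forall fun z => by
          rw [Real.norm_of_nonneg (tiltFactor_pos P Λ hΛ _ _ _).le]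
          exact tiltFactor_le P Λ hΛ _ _ _)
    refine (condExp_prod_ae_eq_integral_condDistrib hX hY.aemeasurable hm.stronglyMeasurable
      hi).trans ?_
    filter_upwards [measureReal_Iio_lowerQuantile P Λ hΛ (hatom h)] with z hz
    simp only [tiltFactor_eq]
    rw [integral_ite_lt, hz]
    field_simp
    ring

end Weights

/-! ### Integrability and the lower bound on conditional means -/

section Bound

variable {Q : Measure (Full 𝒳 k)} [IsProbabilityMeasure Q] {P : Measure (Obs 𝒳)}
  [IsProbabilityMeasure P] {Λ : ℝ}

/-- The observed-data integrand whose integrability means that `Y(a)` has a finite mean. -/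
def inverseWeighted (P : Measure (Obs 𝒳)) [IsProbabilityMeasure P] (a : Bool) (z : Obs 𝒳) : ℝ :=
  z.2.1 * (if z.2.2 = a then 1 else 0) * (1 + oddsAgainst a (propensity P true z.1))

lemma measurable_nominalOddsAgainst (a : Bool) :
    Measurable fun x => oddsAgainst a (propensity P true x) :=
  (measurable_oddsAgainst a).comp (measurable_propensity P true)

lemma nominalOddsAgainst_nonneg (a : Bool) (x : 𝒳) : 0 ≤ oddsAgainst a (propensity P true x) :=
  oddsAgainst_nonneg (propensity_nonneg P _ _) (propensity_le_one P _ _) a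

lemma measurable_inverseWeighted (a : Bool) : Measurable (inverseWeighted P a) := by
  have h1 : Measurable fun z : Obs 𝒳 => (if z.2.2 = a then (1 : ℝ) else 0) :=
    Measurable.ite ((measurable_snd.comp measurable_snd) (measurableSet_singleton a))
      measurable_const measurable_const
  exact ((measurable_fst.comp measurable_snd).mul h1).mul
    (measurable_const.add ((measurable_nominalOddsAgainst a).comp measurable_fst))

lemma outcome_mul_arm (a : Bool) (o : Full 𝒳 k) :
    (observed o).2.1 * (if (observed o).2.2 = a then 1 else 0) = potential a o * arm a o := by
  unfold arm observed
  by_cases h : A o = a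
  · simp [h]
  · simp [h]

lemma inverseWeighted_observed (a : Bool) (o : Full 𝒳 k) : inverseWeighted P a (observed o) =
    potential a o * arm a o * (1 + oddsAgainst a (propensity P true (X o))) := by
  rw [inverseWeighted, outcome_mul_arm]
  rfl

/-- A potential outcome is integrable under a law in the uncertainty set exactly when the inverse
probability weighted outcome is integrable under the observed-data law. -/
lemma integrable_potential_iff (hΛ : 1 ≤ Λ) (hQ : MarginalSensitivity Λ Q)
    (hP : Q.map observed = P) (a : Bool) :
    Integrable (potential a) Q ↔ Integrable (inverseWeighted P a) P := by
  have hmp : Measurable (potential a : Full 𝒳 k → ℝ) := measurable_potential a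
  have hmt : Measurable (trueOddsAgainst Q a) :=
    (measurable_trueOddsAgainst Q a).mono sigmaXUY_le le_rfl
  have hmn : Measurable fun o : Full 𝒳 k => oddsAgainst a (propensity P true (X o)) :=
    (measurable_nominalOddsAgainst a).comp measurable_X
  have e1 : Integrable (inverseWeighted P a) P ↔ Integrable (fun o => potential a o * arm a o *
      (1 + oddsAgainst a (propensity P true (X o)))) Q := by
    have h := integrable_map_measure (μ := Q) (f := observed) (g := inverseWeighted P a)
      (measurable_inverseWeighted a).aestronglyMeasurable measurable_observed.aemeasurable
    rw [hP] at h
    rw [h]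
    refine integrable_congr (Filter.Eventually.of_forall fun o => ?_)
    exact inverseWeighted_observed a o
  have htilt := integrable_mul_trueOddsAgainst_iff hΛ hQ hP a (measurable_potential_sigmaXUY a)
  have harm : ∀ b, (∀ o : Full 𝒳 k, ‖arm b o‖ ≤ 1) := fun b o => by
    rw [Real.norm_of_nonneg (arm_nonneg b o)]; exact arm_le_one b o
  -- Split `Y(a)` over the two arms and turn the counterfactual part into a reweighted factual part.
  have e2 : Integrable (potential a) Q ↔
      Integrable (fun o => potential a o * arm a o * (1 + trueOddsAgainst Q a o)) Q := by
    constructor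
    · intro h
      have i1 : Integrable (fun o => potential a o * arm a o) Q :=
        h.mul_bdd (measurable_arm a).aestronglyMeasurable (Filter.Eventually.of_forall (harm a))
      have i2 : Integrable (fun o => potential a o * arm (!a) o) Q :=
        h.mul_bdd (measurable_arm _).aestronglyMeasurable (Filter.Eventually.of_forall (harm _))
      refine (i1.add (htilt.2 i2)).congr (Filter.Eventually.of_forall fun o => ?_)
      simp only [Pi.add_apply]
      ring
    · intro h
      have i1 : Integrable (fun o => potential a o * arm a o) Q := by
        refine h.mono (by fun_prop) ?_
        filter_upwards [trueOddsAgainst_nonneg (Q := Q) a] with o ho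
        rw [norm_mul (potential a o * arm a o)]
        refine le_mul_of_one_le_right (norm_nonneg _) ?_
        have ho' : 0 ≤ trueOddsAgainst Q a o := ho
        rw [Real.norm_of_nonneg (by positivity)]
        linarith
      have i2 : Integrable (fun o => potential a o * trueOddsAgainst Q a o * arm a o) Q := by
        refine (h.sub i1).congr (Filter.Eventually.of_forall fun o => ?_)
        simp only [Pi.sub_apply]
        ring
      refine (i1.add (htilt.1 i2)).congr (Filter.Eventually.of_forall fun o => ?_)
      simp only [Pi.add_apply]
      rw [← mul_add, arm_add_arm_not, mul_one]
  rw [e1, e2]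
  -- True and nominal odds differ by a factor of at most `Λ`, and `1 ≤ Λ`, so each of the weights `1
  -- +` odds is at most `Λ` times the other.
  have hodds := propensities_of_marginalSensitivity hΛ hQ hP
  constructor
  · intro h
    refine (h.const_mul Λ).mono (by fun_prop) ?_
    filter_upwards [hodds, trueOddsAgainst_nonneg (Q := Q) a] with o ho ho'
    have h1 := nominalOddsAgainst_nonneg (P := P) a (X o)
    have h2 : 0 ≤ trueOddsAgainst Q a o := ho'
    have h3 : oddsAgainst a (propensity P true (X o)) ≤ Λ * trueOddsAgainst Q a o := (ho.2.2 a).2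
    rw [norm_mul, norm_mul Λ, norm_mul (_ * arm a o), Real.norm_of_nonneg (by linarith : (0:ℝ) ≤ Λ),
      mul_left_comm]
    refine mul_le_mul_of_nonneg_left ?_ (norm_nonneg _)
    rw [Real.norm_of_nonneg (by positivity), Real.norm_of_nonneg (by positivity)]
    linarith
  · intro h
    refine (h.const_mul Λ).mono (by fun_prop) ?_
    filter_upwards [hodds, trueOddsAgainst_nonneg (Q := Q) a] with o ho ho'
    have h1 := nominalOddsAgainst_nonneg (P := P) a (X o)
    have h2 : 0 ≤ trueOddsAgainst Q a o := ho'
    have h3 : trueOddsAgainst Q a o ≤ Λ * oddsAgainst a (propensity P true (X o)) := (ho.2.2 a).1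
    rw [norm_mul, norm_mul Λ, norm_mul (_ * arm a o), Real.norm_of_nonneg (by linarith : (0:ℝ) ≤ Λ),
      mul_left_comm]
    refine mul_le_mul_of_nonneg_left ?_ (norm_nonneg _)
    rw [Real.norm_of_nonneg (by positivity), Real.norm_of_nonneg (by positivity)]
    linarith

/-- The worst-case odds against arm `a`. -/
def worstOddsAgainst (P : Measure (Obs 𝒳)) [IsProbabilityMeasure P] (Λ : ℝ) (a : Bool)
    (o : Full 𝒳 k) : ℝ :=
  oddsAgainst a (propensity P true (X o)) * tiltFactor P Λ (X o) a (potential a o)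

lemma measurable_worstOddsAgainst (hΛ : 1 ≤ Λ) (a : Bool) :
    Measurable (worstOddsAgainst P Λ a : Full 𝒳 k → ℝ) :=
  ((measurable_nominalOddsAgainst a).comp measurable_X).mul
    (measurable_tiltFactor P Λ hΛ measurable_X measurable_const (measurable_potential a))

lemma worstOddsAgainst_nonneg (hΛ : 1 ≤ Λ) (a : Bool) (o : Full 𝒳 k) :
    0 ≤ worstOddsAgainst P Λ a o :=
  mul_nonneg (nominalOddsAgainst_nonneg a _) (tiltFactor_pos P Λ hΛ _ _ _).le

lemma lowerIntegrand_observed (a : Bool) (o : Full 𝒳 k) :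
    lowerIntegrand P Λ a (observed o).1 (observed o).2 =
      potential a o * arm a o + potential a o * worstOddsAgainst P Λ a o * arm a o := by
  rw [lowerIntegrand, outcome_mul_arm, odds_propensity]
  by_cases h : A o = a
  · simp only [arm, worstOddsAgainst, observed, h]
    simp
    ring
  · simp [arm, h]

/-- One factor `Λ` bounds the tilt, the other compares nominal with true odds. The crude constant
suffices for the domination argument that gives integrability. -/
lemma worstOddsAgainst_le (hΛ : 1 ≤ Λ) (hQ : MarginalSensitivity Λ Q) (hP : Q.map observed = P)
    (a : Bool) : ∀ᵐ o ∂Q, worstOddsAgainst P Λ a o ≤ Λ * Λ * trueOddsAgainst Q a o := by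
  filter_upwards [propensities_of_marginalSensitivity hΛ hQ hP] with o ho
  have h1 := nominalOddsAgainst_nonneg (P := P) a (X o)
  have h3 : oddsAgainst a (propensity P true (X o)) ≤ Λ * trueOddsAgainst Q a o := (ho.2.2 a).2
  calc worstOddsAgainst P Λ a o ≤ oddsAgainst a (propensity P true (X o)) * Λ :=
        mul_le_mul_of_nonneg_left (tiltFactor_le P Λ hΛ _ _ _) h1
    _ ≤ (Λ * trueOddsAgainst Q a o) * Λ := mul_le_mul_of_nonneg_right h3 (by linarith)
    _ = _ := by ring

lemma integrable_mul_worstOddsAgainst (hΛ : 1 ≤ Λ) (hQ : MarginalSensitivity Λ Q)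
    (hP : Q.map observed = P) (a : Bool) {T : Full 𝒳 k → ℝ} (hT : Measurable T)
    (h : Integrable (fun o => T o * trueOddsAgainst Q a o * arm a o) Q) :
    Integrable (fun o => T o * worstOddsAgainst P Λ a o * arm a o) Q := by
  have hw := measurable_worstOddsAgainst (P := P) (k := k) hΛ a
  refine (h.const_mul (Λ * Λ)).mono (by fun_prop) ?_
  filter_upwards [worstOddsAgainst_le hΛ hQ hP a, trueOddsAgainst_nonneg (Q := Q) a] with o h1 h2
  have h2' : 0 ≤ trueOddsAgainst Q a o := h2
  have h3 := worstOddsAgainst_nonneg (P := P) hΛ a o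
  have h4 := arm_nonneg a o
  have hΛ0 : 0 ≤ Λ := by linarith
  simp only [norm_mul, Real.norm_of_nonneg h2', Real.norm_of_nonneg h3, Real.norm_of_nonneg h4,
    Real.norm_of_nonneg hΛ0]
  calc ‖T o‖ * worstOddsAgainst P Λ a o * arm a o
      ≤ ‖T o‖ * (Λ * Λ * trueOddsAgainst Q a o) * arm a o := by gcongr
    _ = _ := by ring

/-- The σ-algebra generated by the covariates and the treatment. -/
abbrev sigmaXA (𝒳 : Type*) [MeasurableSpace 𝒳] (k : ℕ) : MeasurableSpace (Full 𝒳 k) :=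
  MeasurableSpace.comap (fun o => (X o, A o)) inferInstance

/-- The worst-case odds reproduce the conditional probability of the other arm. -/
lemma condExp_worstOddsAgainst_mul_arm (hΛ : 1 ≤ Λ) (hQ : MarginalSensitivity Λ Q)
    (hP : Q.map observed = P)
    (hatom : 1 < Λ → P {z | z.2.1 = lowerQuantile P Λ z.1 z.2.2} = 0) (a : Bool)
    (hi : Integrable (fun o => worstOddsAgainst P Λ a o * arm a o) Q) :
    Q[fun o => worstOddsAgainst P Λ a o * arm a o | sigmaX 𝒳 k] =ᵐ[Q]
      Q[arm (!a) | sigmaX 𝒳 k] := by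
  set s : Obs 𝒳 → ℝ := fun z => tiltFactor P Λ z.1 z.2.2 z.2.1 with hs
  have hsm : Measurable s := measurable_tiltFactor P Λ hΛ (by fun_prop) (by fun_prop) (by fun_prop)
  have hsb : ∀ z, ‖s z‖ ≤ Λ := fun z => by
    rw [Real.norm_of_nonneg (tiltFactor_pos P Λ hΛ _ _ _).le]
    exact tiltFactor_le P Λ hΛ _ _ _
  have hsP : Integrable s P := Integrable.of_bound hsm.aestronglyMeasurable Λ
    (Filter.Eventually.of_forall hsb)
  have hsQ : Integrable (s ∘ observed) Q :=
    Integrable.of_bound (hsm.comp measurable_observed).aestronglyMeasurable Λ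
      (Filter.Eventually.of_forall fun o => hsb _)
  have hXA : sigmaXA 𝒳 k ≤ (inferInstance : MeasurableSpace (Full 𝒳 k)) :=
    Measurable.comap_le (by fun_prop)
  have hXXA : sigmaX 𝒳 k ≤ sigmaXA 𝒳 k := by
    rintro _ ⟨t, ht, rfl⟩
    exact ⟨Prod.fst ⁻¹' t, measurable_fst ht, rfl⟩
  have c1 : Q[s ∘ observed | sigmaXA 𝒳 k] =ᵐ[Q] fun _ => 1 := by
    subst hP
    refine (condExp_map_comp (h := fun z : Obs 𝒳 => (z.1, z.2.2)) measurable_observed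
      (by fun_prop) hsP).symm.trans ?_
    exact ae_of_ae_map measurable_observed.aemeasurable (condExp_tiltFactor _ Λ hΛ hatom)
  have hcm : Measurable[sigmaXA 𝒳 k] fun o : Full 𝒳 k => (X o, A o) := comap_measurable _
  set f : Full 𝒳 k → ℝ := fun o => oddsAgainst a (propensity P true (X o)) * arm a o with hf
  have hfm : Measurable[sigmaXA 𝒳 k] f :=
    ((measurable_nominalOddsAgainst a).comp (measurable_fst.comp hcm)).mul
      (Measurable.ite ((measurable_snd.comp hcm) (measurableSet_singleton a)) measurable_const
        measurable_const)
  -- On arm `a` the potential outcome is the observed one, so the tilt is a function of the observed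
  -- data and has mean one given `(X, A)`.
  have e : (fun o => worstOddsAgainst P Λ a o * arm a o) = f * (s ∘ observed) := by
    funext o
    simp only [Pi.mul_apply, hf, hs, Function.comp, worstOddsAgainst, arm, observed]
    by_cases h : A o = a
    · simp [h]
    · simp [h]
  rw [e] at hi ⊢
  have c2 : Q[f * (s ∘ observed) | sigmaXA 𝒳 k] =ᵐ[Q] f := by
    refine (condExp_mul_of_stronglyMeasurable_left hfm.stronglyMeasurable hi hsQ).trans ?_
    filter_upwards [c1] with o ho
    rw [Pi.mul_apply, ho, mul_one]
  -- The nominal odds need not be bounded; `f` is integrable because it is almost surely a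
  -- conditional expectation.
  have hfi : Integrable f Q := integrable_condExp.congr c2
  have hn : StronglyMeasurable[sigmaX 𝒳 k] fun o : Full 𝒳 k =>
      oddsAgainst a (propensity P true (X o)) :=
    (Measurable.comp (g := fun x => oddsAgainst a (propensity P true x)) (f := X)
      (measurable_nominalOddsAgainst a) (comap_measurable _)).stronglyMeasurable
  refine (condExp_condExp_of_le hXXA hXA).symm.trans ((condExp_congr_ae c2).trans ?_)
  refine (condExp_mul_of_stronglyMeasurable_left hn hfi (integrable_arm a Q)).trans ?_
  filter_upwards [condExp_arm_sigmaX hP a, condExp_arm_sigmaX hP (!a),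
    propensities_of_marginalSensitivity hΛ hQ hP] with o h1 h2 h3
  rw [Pi.mul_apply, h1, h2, propensity_eq_armProb P a, propensity_eq_armProb P (!a), oddsAgainst,
    div_mul_cancel₀]
  cases a
  · exact (sub_pos.2 h3.2.1.2).ne'
  · exact h3.2.1.1.ne'

lemma ae_condExp_lowerIntegrand (hΛ : 1 ≤ Λ) (hP : Q.map observed = P) (a : Bool)
    (hi : Integrable (fun o => lowerIntegrand P Λ a (observed o).1 (observed o).2) Q) :
    Q[fun o => lowerIntegrand P Λ a (observed o).1 (observed o).2 | sigmaX 𝒳 k] =ᵐ[Q]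
      fun o => lowerMean P Λ (X o) a := by
  have hY2 : Measurable fun o : Full 𝒳 k => (observed o).2 :=
    measurable_snd.comp measurable_observed
  have hf : StronglyMeasurable fun z : 𝒳 × (ℝ × Bool) => lowerIntegrand P Λ a z.1 z.2 :=
    (measurable_lowerIntegrand P Λ hΛ a).stronglyMeasurable
  have h := condExp_prod_ae_eq_integral_condDistrib (μ := Q) measurable_X hY2.aemeasurable hf hi
  refine h.trans (Filter.Eventually.of_forall fun o => ?_)
  simp only [lowerMean_eq]
  rw [condDistrib_observed hP measurable_fst (by fun_prop)]
  rfl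

variable (hΛ : 1 ≤ Λ) (hQ : MarginalSensitivity Λ Q) (hP : Q.map observed = P)
  (hatom : 1 < Λ → P {z | z.2.1 = lowerQuantile P Λ z.1 z.2.2} = 0) (a : Bool)
  (hY : Integrable (potential a) Q)

include hΛ hQ hP hY in
/-- The conditional mean of a potential outcome exceeds the bound by the mean of the outcome
against the difference between true and worst-case odds. -/
lemma condExp_potential_eq_lowerMean_add :
    Integrable (fun o => potential a o *
      (trueOddsAgainst Q a o * arm a o - worstOddsAgainst P Λ a o * arm a o)) Q ∧
    Q[potential a | sigmaX 𝒳 k] =ᵐ[Q] fun o => lowerMean P Λ (X o) a +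
      (Q[fun o => potential a o * (trueOddsAgainst Q a o * arm a o -
        worstOddsAgainst P Λ a o * arm a o) | sigmaX 𝒳 k]) o := by
  have hm := measurable_potential_sigmaXUY (𝒳 := 𝒳) (k := k) a
  have hb : ∀ b, ∀ᵐ o ∂Q, ‖(arm b o : ℝ)‖ ≤ 1 := fun b => Filter.Eventually.of_forall fun o => by
    rw [Real.norm_of_nonneg (arm_nonneg b o)]; exact arm_le_one b o
  have iA : Integrable (fun o => potential a o * arm a o) Q :=
    hY.mul_bdd (measurable_arm a).aestronglyMeasurable (hb a)
  have iB : Integrable (fun o => potential a o * arm (!a) o) Q :=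
    hY.mul_bdd (measurable_arm _).aestronglyMeasurable (hb _)
  have iT := (integrable_mul_trueOddsAgainst_iff hΛ hQ hP a hm).2 iB
  have iS := integrable_mul_worstOddsAgainst hΛ hQ hP a (measurable_potential a) iT
  have eY : (potential a : Full 𝒳 k → ℝ) =
      (fun o => potential a o * arm a o) + fun o => potential a o * arm (!a) o := by
    funext o
    rw [Pi.add_apply, ← mul_add, arm_add_arm_not, mul_one]
  have eL : (fun o : Full 𝒳 k => lowerIntegrand P Λ a (observed o).1 (observed o).2) =
      (fun o => potential a o * arm a o) +
        fun o => potential a o * worstOddsAgainst P Λ a o * arm a o := by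
    funext o
    exact lowerIntegrand_observed a o
  have eD : (fun o => potential a o * (trueOddsAgainst Q a o * arm a o -
      worstOddsAgainst P Λ a o * arm a o)) =
      (fun o => potential a o * trueOddsAgainst Q a o * arm a o) -
        fun o => potential a o * worstOddsAgainst P Λ a o * arm a o := by
    funext o
    simp only [Pi.sub_apply]
    ring
  have hL := ae_condExp_lowerIntegrand hΛ hP a (by rw [eL]; exact iA.add iS)
  rw [eL] at hL
  rw [eD]
  refine ⟨iT.sub iS, ?_⟩
  have hYc : Q[potential a | sigmaX 𝒳 k] =ᵐ[Q] Q[fun o => potential a o * arm a o | sigmaX 𝒳 k] +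
      Q[fun o => potential a o * arm (!a) o | sigmaX 𝒳 k] := by
    conv_lhs => rw [eY]
    exact condExp_add iA iB _
  filter_upwards [hYc, hL, condExp_add iA iS (sigmaX 𝒳 k), condExp_sub iT iS (sigmaX 𝒳 k),
    condExp_mul_trueOddsAgainst hΛ hQ hP a hm iB] with o h1 h2 h3 h4 h5
  simp only [Pi.add_apply, Pi.sub_apply] at h1 h3 h4
  rw [h1, h4, ← h2, h3, h5]
  ring

include hΛ hQ hP hatom hY in
-- Neyman-Pearson argument. On arm `a`, true and worst-case odds have the same mean given `X`,
-- namely the probability of the other arm. The worst-case odds sit at the upper end of the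
-- admissible interval below the quantile and at the lower end above it, so true minus worst-case
-- odds has the sign of `Y(a) - q`.
theorem lowerMean_le_condExp_potential :
    ∀ᵐ o ∂Q, lowerMean P Λ (X o) a ≤ (Q[potential a | sigmaX 𝒳 k]) o := by
  obtain ⟨hTD, hc⟩ := condExp_potential_eq_lowerMean_add hΛ hQ hP a hY
  -- The moment constraint is the reweighting identity for `T = 1`.
  have i1 : Integrable (fun o => trueOddsAgainst Q a o * arm a o) Q := by
    have := (integrable_mul_trueOddsAgainst_iff hΛ hQ hP a (T := fun _ => 1) measurable_const).2
      (by simpa using integrable_arm _ Q)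
    simpa using this
  have i2 : Integrable (fun o => worstOddsAgainst P Λ a o * arm a o) Q := by
    have := integrable_mul_worstOddsAgainst hΛ hQ hP a (T := fun _ => 1) measurable_const
      (by simpa using i1)
    simpa using this
  have c1 : Q[fun o => trueOddsAgainst Q a o * arm a o | sigmaX 𝒳 k] =ᵐ[Q]
      Q[arm (!a) | sigmaX 𝒳 k] := by
    have := condExp_mul_trueOddsAgainst hΛ hQ hP a (T := fun _ => 1) measurable_const
      (by simpa using integrable_arm _ Q)
    simpa using this
  have c2 := condExp_worstOddsAgainst_mul_arm hΛ hQ hP hatom a i2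
  have hD0 : Q[fun o => trueOddsAgainst Q a o * arm a o - worstOddsAgainst P Λ a o * arm a o |
      sigmaX 𝒳 k] =ᵐ[Q] 0 := by
    refine (condExp_sub i1 i2 _).trans ?_
    filter_upwards [c1, c2] with o h1 h2
    rw [Pi.sub_apply, h1, h2, sub_self, Pi.zero_apply]
  have hq : Measurable[sigmaX 𝒳 k] fun o : Full 𝒳 k => lowerQuantile P Λ (X o) a :=
    ((measurable_lowerQuantile P Λ hΛ).comp (measurable_id.prodMk measurable_const)).comp
      (comap_measurable _)
  have i3 : Integrable (fun o => trueOddsAgainst Q a o * arm a o -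
      worstOddsAgainst P Λ a o * arm a o) Q := i1.sub i2
  have key := condExp_mul_nonneg_of_threshold sigmaX_le hq i3 hTD hD0 (by
    filter_upwards [propensities_of_marginalSensitivity hΛ hQ hP] with o ho
    obtain ⟨h1, h2⟩ := ho.2.2 a
    have h0 := arm_nonneg a o
    rw [← sub_mul, ← mul_assoc]
    refine mul_nonneg ?_ h0
    unfold worstOddsAgainst trueOddsAgainst
    rw [tiltFactor_eq]
    split_ifs with h
    · exact mul_nonneg_of_nonpos_of_nonpos (by linarith) (by linarith)
    · refine mul_nonneg (by linarith) (sub_nonneg.2 ?_)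
      rw [← div_eq_mul_inv, div_le_iff₀ (by linarith)]
      linarith)
  filter_upwards [hc, key] with o h1 h2
  rw [h1]
  simp only [Pi.zero_apply] at h2
  linarith

include hΛ hQ hP hY in
-- The excess over the bound carries the indicator of arm `a`, so agreement of the odds on that arm
-- suffices.
theorem condExp_potential_eq_lowerMean
    (h : ∀ᵐ o ∂Q, A o = a → trueOddsAgainst Q a o = worstOddsAgainst P Λ a o) :
    ∀ᵐ o ∂Q, (Q[potential a | sigmaX 𝒳 k]) o = lowerMean P Λ (X o) a := by
  obtain ⟨-, hc⟩ := condExp_potential_eq_lowerMean_add hΛ hQ hP a hY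
  have h0 : (fun o => potential a o * (trueOddsAgainst Q a o * arm a o -
      worstOddsAgainst P Λ a o * arm a o)) =ᵐ[Q] 0 := by
    filter_upwards [h] with o ho
    by_cases hA : A o = a
    · simp [ho hA]
    · simp [arm, hA]
  filter_upwards [hc, condExp_congr_ae (m := sigmaX 𝒳 k) h0] with o h1 h2
  rw [h1, h2, condExp_zero]
  simp

end Bound

/-! ### Completing the observed data by a draw from the other arm -/

section CrossLaw

variable (P : Measure (Obs 𝒳)) [IsProbabilityMeasure P] (c : Obs 𝒳 → Fin k → ℝ)

/-- The conditional law of the outcome given covariates, confounder and treatment. -/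
def outcomeKernel : Kernel ((𝒳 × (Fin k → ℝ)) × Bool) ℝ :=
  condDistrib (fun z : Obs 𝒳 => z.2.1) (fun z => ((z.1, c z), z.2.2)) P

instance : IsMarkovKernel (outcomeKernel P c) := by unfold outcomeKernel; infer_instance

lemma measurable_pair_not {α : Type*} [MeasurableSpace α] :
    Measurable fun w : α × Bool => (w.1, !w.2) :=
  measurable_fst.prodMk ((measurable_of_finite (fun b : Bool => !b)).comp measurable_snd)

/-- The conditional law of the outcome in the other arm. -/
def swappedKernel : Kernel ((𝒳 × (Fin k → ℝ)) × Bool) ℝ :=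
  (outcomeKernel P c).comap (fun w => (w.1, !w.2)) measurable_pair_not

instance : IsMarkovKernel (swappedKernel P c) := by unfold swappedKernel; infer_instance

/-- The joint conditional law of the potential outcomes: independent draws from the two arms. -/
def outcomesKernel : Kernel (𝒳 × (Fin k → ℝ)) (ℝ × ℝ) :=
  (outcomeKernel P c).comap (fun w => (w, true)) (by fun_prop) ×ₖ
    (outcomeKernel P c).comap (fun w => (w, false)) (by fun_prop)

instance : IsMarkovKernel (outcomesKernel P c) := by unfold outcomesKernel; infer_instance

/-- Full data from the observed data, an outcome for the other arm, and the confounder `c`. -/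
def completeData (w : Obs 𝒳 × ℝ) : Full 𝒳 k :=
  (if w.1.2.2 = true then w.1.2.1 else w.2, if w.1.2.2 = true then w.2 else w.1.2.1,
    w.1.1, w.1.2.2, c w.1)

variable {c} (hc : Measurable c)

include hc in
lemma measurable_completeData : Measurable (completeData c) := by
  have hA : MeasurableSet {w : Obs 𝒳 × ℝ | w.1.2.2 = true} :=
    (by fun_prop : Measurable fun w : Obs 𝒳 × ℝ => w.1.2.2) (measurableSet_singleton true)
  exact (Measurable.ite hA (by fun_prop) (by fun_prop)).prodMk
    ((Measurable.ite hA (by fun_prop) (by fun_prop)).prodMk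
      (by fun_prop : Measurable fun w : Obs 𝒳 × ℝ => (w.1.1, w.1.2.2, c w.1)))

/-- The law of the observed data together with an independent draw from the other arm. -/
def crossDraw : Measure (Obs 𝒳 × ℝ) :=
  P ⊗ₘ (swappedKernel P c).comap (fun z : Obs 𝒳 => ((z.1, c z), z.2.2)) (by fun_prop)

instance : IsProbabilityMeasure (crossDraw P hc) := by unfold crossDraw; infer_instance

/-- The full-data law in which the counterfactual outcome is drawn from the other arm, given
the covariates and the confounder `c`. -/
def crossLaw : Measure (Full 𝒳 k) := (crossDraw P hc).map (completeData c)

instance : IsProbabilityMeasure (crossLaw P hc) :=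
  Measure.isProbabilityMeasure_map (measurable_completeData hc).aemeasurable

lemma observed_completeData (w : Obs 𝒳 × ℝ) : observed (completeData c w) = w.1 := by
  obtain ⟨⟨x, y, a⟩, y'⟩ := w
  cases a <;> rfl

lemma map_observed_crossLaw : (crossLaw P hc).map observed = P := by
  rw [crossLaw, Measure.map_map measurable_observed (measurable_completeData hc)]
  have h : observed ∘ completeData c = (Prod.fst : Obs 𝒳 × ℝ → Obs 𝒳) := by
    funext w; exact observed_completeData w
  rw [h]
  exact Measure.fst_compProd _ _

/-- For a treated unit the observed outcome comes from the treated kernel and the draw from the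
control kernel; for an untreated unit the roles are exchanged. Either way `(Y(1), Y(0))` has the
same product law given `(X, U)`, free of `A`. -/
lemma map_crossLaw_eq_compProd :
    (crossLaw P hc).map (fun o => (((X o, U o), A o), (Y1 o, Y0 o))) =
      (crossLaw P hc).map (fun o => ((X o, U o), A o)) ⊗ₘ
        (outcomesKernel P c).prodMkRight Bool := by
  have hm := measurable_completeData hc
  have hw : Measurable fun z : Obs 𝒳 => ((z.1, c z), z.2.2) := by fun_prop
  have h1 : (crossLaw P hc).map (fun o => ((X o, U o), A o)) =
      P.map fun z : Obs 𝒳 => ((z.1, c z), z.2.2) := by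
    have e : (crossDraw P hc).map Prod.fst = P := Measure.fst_compProd _ _
    conv_rhs => rw [← e]
    rw [crossLaw, Measure.map_map (by fun_prop) hm, Measure.map_map hw measurable_fst]
    rfl
  rw [h1]
  refine Measure.ext_of_lintegral _ fun F hF => ?_
  -- `f` takes the pair (factual, counterfactual) and puts it in the order (treated, control).
  set f : ((𝒳 × (Fin k → ℝ)) × Bool) × ℝ × ℝ → ENNReal := fun t =>
    F (t.1, (if t.1.2 = true then t.2.1 else t.2.2, if t.1.2 = true then t.2.2 else t.2.1)) with hf
  have hb : MeasurableSet {t : ((𝒳 × (Fin k → ℝ)) × Bool) × ℝ × ℝ | t.1.2 = true} :=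
    (by fun_prop : Measurable fun t : ((𝒳 × (Fin k → ℝ)) × Bool) × ℝ × ℝ => t.1.2)
      (measurableSet_singleton true)
  have hfm : Measurable f := hF.comp (measurable_fst.prodMk
    ((Measurable.ite hb (by fun_prop) (by fun_prop)).prodMk
      (Measurable.ite hb (by fun_prop) (by fun_prop))))
  set G : ((𝒳 × (Fin k → ℝ)) × Bool) × ℝ → ENNReal := fun t =>
    ∫⁻ y', f (t.1, t.2, y') ∂(swappedKernel P c t.1) with hG
  have hGm : Measurable G := by
    have := Measurable.lintegral_kernel_prod_right'
      (κ := (swappedKernel P c).comap (Prod.fst : ((𝒳 × (Fin k → ℝ)) × Bool) × ℝ → _)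
        measurable_fst) (f := fun t => f (t.1.1, t.1.2, t.2)) (by fun_prop)
    exact this
  have hL : ∫⁻ t, F t ∂((crossLaw P hc).map (fun o => (((X o, U o), A o), (Y1 o, Y0 o)))) =
      ∫⁻ z, G (((z.1, c z), z.2.2), z.2.1) ∂P := by
    rw [lintegral_map hF (by fun_prop), crossLaw, lintegral_map (by fun_prop) hm, crossDraw,
      Measure.lintegral_compProd]
    · rfl
    · exact (hF.comp (by fun_prop : Measurable fun o : Full 𝒳 k =>
        (((X o, U o), A o), (Y1 o, Y0 o)))).comp hm
  have hκ : P.map (fun z : Obs 𝒳 => (((z.1, c z), z.2.2), z.2.1)) =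
      P.map (fun z : Obs 𝒳 => ((z.1, c z), z.2.2)) ⊗ₘ outcomeKernel P c :=
    (compProd_map_condDistrib (by fun_prop)).symm
  have hL2 : ∫⁻ z, G (((z.1, c z), z.2.2), z.2.1) ∂P =
      ∫⁻ t, G t ∂(P.map (fun z : Obs 𝒳 => (((z.1, c z), z.2.2), z.2.1))) :=
    (lintegral_map hGm (by fun_prop)).symm
  rw [hL, hL2, hκ, Measure.lintegral_compProd hGm, Measure.lintegral_compProd hF]
  refine lintegral_congr fun t => ?_
  obtain ⟨w, a⟩ := t
  have hFw : Measurable fun y : ℝ × ℝ => F ((w, a), y) := by fun_prop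
  have hR : ∫⁻ y, F ((w, a), y) ∂((outcomesKernel P c).prodMkRight Bool (w, a)) =
      ∫⁻ y1, ∫⁻ y0, F ((w, a), (y1, y0)) ∂(outcomeKernel P c (w, false))
        ∂(outcomeKernel P c (w, true)) := by
    rw [Kernel.prodMkRight_apply, outcomesKernel, Kernel.prod_apply,
      lintegral_prod _ hFw.aemeasurable]
    rfl
  rw [hR]
  cases a
  -- In the control arm the factual outcome `Y(0)` is the outer variable, so Tonelli is needed.
  · rw [lintegral_lintegral_swap hFw.aemeasurable]
    simp [hG, hf, swappedKernel, Kernel.comap_apply]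
  · simp [hG, hf, swappedKernel, Kernel.comap_apply]

lemma condIndepFun_crossLaw :
    CondIndepFun (sigmaXU 𝒳 k) sigmaXU_le (fun o => (Y1 o, Y0 o)) A (crossLaw P hc) :=
  (condIndepFun_of_map_eq_compProd_prodMkRight (measurable_X.prodMk measurable_U) measurable_A
    (measurable_Y1.prodMk measurable_Y0) (outcomesKernel P c)
    (map_crossLaw_eq_compProd P hc)).symm

lemma ae_crossLaw_iff {p : Full 𝒳 k → Prop} (hp : MeasurableSet {o | p o}) :
    (∀ᵐ o ∂(crossLaw P hc), p o) ↔ ∀ᵐ w ∂(crossDraw P hc), p (completeData c w) :=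
  ae_map_iff (measurable_completeData hc).aemeasurable hp

lemma confounder_crossLaw : ∀ᵐ o ∂(crossLaw P hc), U o = c (observed o) := by
  refine (ae_crossLaw_iff P hc
    (measurableSet_eq_fun measurable_U (hc.comp measurable_observed))).2 ?_
  exact Filter.Eventually.of_forall fun w => by
    rw [Function.comp_apply, observed_completeData]; rfl

/-- Here `(X, U, A)` is a function of the observed data, so the propensity can be computed under
`P`; both sides are pulled back to `crossDraw` and compared there. -/
lemma truePropensity_crossLaw {r : 𝒳 × (Fin k → ℝ) → ℝ} (hr : Measurable r)
    (h : P[fun z => if z.2.2 = true then (1 : ℝ) else 0 |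
      MeasurableSpace.comap (fun z : Obs 𝒳 => (z.1, c z)) inferInstance] =ᵐ[P]
        fun z => r (z.1, c z)) :
    truePropensity (crossLaw P hc) =ᵐ[crossLaw P hc] fun o => r (X o, U o) := by
  have hm := measurable_completeData hc
  have hT : Measurable (truePropensity (crossLaw P hc)) :=
    (stronglyMeasurable_condExp.mono sigmaXU_le).measurable
  refine (ae_crossLaw_iff P hc (measurableSet_eq_fun hT
    (hr.comp (measurable_X.prodMk measurable_U)))).2 ?_
  have hi := integrable_arm true (crossLaw P hc)
  have e1 := condExp_map_comp (μ := crossDraw P hc) hm (measurable_X.prodMk measurable_U) hi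
  have hfst : (crossDraw P hc).map Prod.fst = P := Measure.fst_compProd _ _
  have hA : MeasurableSet {z : Obs 𝒳 | z.2.2 = true} :=
    (by fun_prop : Measurable fun z : Obs 𝒳 => z.2.2) (measurableSet_singleton true)
  have hi2 : Integrable (fun z : Obs 𝒳 => if z.2.2 = true then (1 : ℝ) else 0)
      ((crossDraw P hc).map Prod.fst) :=
    Integrable.of_bound (Measurable.ite hA measurable_const measurable_const).aestronglyMeasurable 1
      (Filter.Eventually.of_forall fun z => by split_ifs <;> simp)
  have e2 := condExp_map_comp (μ := crossDraw P hc) measurable_fst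
    (by fun_prop : Measurable fun z : Obs 𝒳 => (z.1, c z)) hi2
  rw [← hfst] at h
  have h' := ae_of_ae_map measurable_fst.aemeasurable h
  rw [arm_eq_indicator] at e1
  have e12 : ((A ⁻¹' {true}).indicator (fun _ => (1 : ℝ)) : Full 𝒳 k → ℝ) ∘ completeData c =
      (fun z : Obs 𝒳 => if z.2.2 = true then (1 : ℝ) else 0) ∘ Prod.fst := by
    rw [← arm_eq_indicator]
    rfl
  rw [e12] at e1
  filter_upwards [e1, e2, h'] with w h1 h2 h3
  exact (h1.trans h2.symm).trans h3

end CrossLaw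

/-! ### The least favourable confounder and its propensity -/

section WorstCase

variable (P : Measure (Obs 𝒳)) [IsProbabilityMeasure P] (k) (Λ : ℝ)

open Classical in
/-- The confounder of the worst-case law: it marks treated units with high and untreated units with
low outcomes. -/
def worstConfounder (z : Obs 𝒳) : Fin k → ℝ := fun _ =>
  if 1 < Λ ∧ (z.2.2 = true ↔ lowerQuantile P Λ z.1 z.2.2 ≤ z.2.1) then 1 else 0

lemma measurable_worstConfounder (hΛ : 1 ≤ Λ) : Measurable (worstConfounder k P Λ) := by
  have hq : Measurable fun z : Obs 𝒳 => lowerQuantile P Λ z.1 z.2.2 :=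
    Measurable.comp (g := fun w : 𝒳 × Bool => lowerQuantile P Λ w.1 w.2)
      (f := fun z : Obs 𝒳 => (z.1, z.2.2)) (measurable_lowerQuantile P Λ hΛ) (by fun_prop)
  have hA : MeasurableSet {z : Obs 𝒳 | z.2.2 = true} :=
    (by fun_prop : Measurable fun z : Obs 𝒳 => z.2.2) (measurableSet_singleton true)
  have hB : MeasurableSet {z : Obs 𝒳 | lowerQuantile P Λ z.1 z.2.2 ≤ z.2.1} :=
    measurableSet_le hq (by fun_prop)
  refine measurable_pi_lambda _ fun _ => ?_
  refine Measurable.ite ?_ measurable_const measurable_const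
  exact (MeasurableSet.const _).inter (hA.iff hB)

variable {k}

/-- The odds ratio between true and nominal propensity under the worst-case law. -/
def worstOddsRatio (i : Fin k) (u : Fin k → ℝ) : ℝ := if u i = 1 then Λ else Λ⁻¹

/-- The propensity given covariates and confounder under the worst-case law. -/
def worstPropensity (i : Fin k) (w : 𝒳 × (Fin k → ℝ)) : ℝ :=
  propensity P true w.1 * worstOddsRatio Λ i w.2 /
    (propensity P true w.1 * worstOddsRatio Λ i w.2 + (1 - propensity P true w.1))

lemma worstOddsRatio_pos (hΛ : 1 ≤ Λ) (i : Fin k) (u : Fin k → ℝ) : 0 < worstOddsRatio Λ i u := by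
  unfold worstOddsRatio; split_ifs <;> positivity

lemma measurable_worstOddsRatio (i : Fin k) : Measurable (worstOddsRatio Λ i) :=
  Measurable.ite ((measurable_pi_apply i) (measurableSet_singleton 1)) measurable_const
    measurable_const

lemma measurable_worstPropensity (i : Fin k) : Measurable (worstPropensity P Λ i) := by
  have h1 : Measurable fun w : 𝒳 × (Fin k → ℝ) => propensity P true w.1 := by fun_prop
  have h2 : Measurable fun w : 𝒳 × (Fin k → ℝ) => worstOddsRatio Λ i w.2 :=
    (measurable_worstOddsRatio Λ i).comp measurable_snd
  exact (h1.mul h2).div ((h1.mul h2).add (measurable_const.sub h1))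

lemma worstPropensity_denom_pos (hΛ : 1 ≤ Λ) (i : Fin k) (w : 𝒳 × (Fin k → ℝ)) :
    0 < propensity P true w.1 * worstOddsRatio Λ i w.2 + (1 - propensity P true w.1) := by
  have h1 := propensity_nonneg P true w.1
  have h2 := propensity_le_one P true w.1
  have h3 := worstOddsRatio_pos Λ hΛ i w.2
  rcases h1.eq_or_lt with h | h
  · rw [← h]; norm_num
  · have := mul_pos h h3
    linarith

lemma worstPropensity_mem_Icc (hΛ : 1 ≤ Λ) (i : Fin k) (w : 𝒳 × (Fin k → ℝ)) :
    0 ≤ worstPropensity P Λ i w ∧ worstPropensity P Λ i w ≤ 1 := by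
  have h0 := worstPropensity_denom_pos P Λ hΛ i w
  have h1 := propensity_nonneg P true w.1
  have h2 := propensity_le_one P true w.1
  have h3 := worstOddsRatio_pos Λ hΛ i w.2
  refine ⟨div_nonneg (by positivity) h0.le, ?_⟩
  rw [worstPropensity, div_le_one h0]
  linarith

/-- Bayes' rule with denominators cleared: if a confounder value is `worstOddsRatio` times as likely
among the treated as among the untreated, the residual of the propensity averages to zero at that
value. -/
lemma worstPropensity_balance (hΛ : 1 ≤ Λ) (i : Fin k) (w : 𝒳 × (Fin k → ℝ)) :
    propensity P true w.1 * worstOddsRatio Λ i w.2 * (worstPropensity P Λ i w - 1) +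
      (1 - propensity P true w.1) * worstPropensity P Λ i w = 0 := by
  have h0 := (worstPropensity_denom_pos P Λ hΛ i w).ne'
  unfold worstPropensity
  field_simp
  ring

lemma odds_worstPropensity (hΛ : 1 ≤ Λ) (i : Fin k) (w : 𝒳 × (Fin k → ℝ)) :
    odds (worstPropensity P Λ i w) = odds (propensity P true w.1) * worstOddsRatio Λ i w.2 := by
  have h0 := (worstPropensity_denom_pos P Λ hΛ i w).ne'
  have h1 : 1 - worstPropensity P Λ i w = (1 - propensity P true w.1) /
      (propensity P true w.1 * worstOddsRatio Λ i w.2 + (1 - propensity P true w.1)) := by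
    unfold worstPropensity
    field_simp
    ring
  rw [odds, h1, worstPropensity, div_div_div_cancel_right₀ h0, odds]
  ring

/-- A function of covariates and treatment that averages to zero over the treatment arms has
zero mean. -/
lemma integral_eq_zero_of_arm_average {K : 𝒳 × Bool → ℝ} (hK : Measurable K) {C : ℝ}
    (hC : ∀ w, ‖K w‖ ≤ C)
    (h : ∀ x, propensity P true x * K (x, true) + (1 - propensity P true x) * K (x, false) = 0) :
    ∫ z, K (z.1, z.2.2) ∂P = 0 := by
  have hi : Integrable (fun z : Obs 𝒳 => K (z.1, z.2.2)) P :=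
    Integrable.of_bound (hK.comp (by fun_prop)).aestronglyMeasurable C
      (Filter.Eventually.of_forall fun z => hC _)
  have hX : Measurable fun z : Obs 𝒳 => z.1 := measurable_fst
  have hA : Measurable fun z : Obs 𝒳 => z.2.2 := by fun_prop
  have hc := condExp_prod_ae_eq_integral_condDistrib hX hA.aemeasurable hK.stronglyMeasurable hi
  rw [← integral_condExp hX.comap_le, integral_congr_ae hc]
  refine integral_eq_zero_of_ae (Filter.Eventually.of_forall fun z => ?_)
  simp only [Pi.zero_apply]
  rw [integral_fintype .of_finite]
  simp only [Fintype.sum_bool, smul_eq_mul]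
  have h1 := h z.1
  have h2 : propensity P false z.1 = 1 - propensity P true z.1 := by
    rw [propensity_eq_armProb]; rfl
  rw [← h2] at h1
  exact h1

/-- Integrating out the outcome when it only matters whether it lies below its quantile. -/
lemma integral_ite_lt_lowerQuantile (hΛ : 1 ≤ Λ)
    (hatom : P {z | z.2.1 = lowerQuantile P Λ z.1 z.2.2} = 0) {α β : 𝒳 × Bool → ℝ}
    (hα : Measurable α) (hβ : Measurable β) {C : ℝ} (hαC : ∀ w, ‖α w‖ ≤ C)
    (hβC : ∀ w, ‖β w‖ ≤ C) :
    ∫ z, (if z.2.1 < lowerQuantile P Λ z.1 z.2.2 then α (z.1, z.2.2) else β (z.1, z.2.2)) ∂P =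
      ∫ z, (α (z.1, z.2.2) * (1 / (1 + Λ)) + β (z.1, z.2.2) * (1 - 1 / (1 + Λ))) ∂P := by
  have hX : Measurable fun z : Obs 𝒳 => (z.1, z.2.2) := by fun_prop
  have hY : Measurable fun z : Obs 𝒳 => z.2.1 := by fun_prop
  have hq : Measurable fun t : (𝒳 × Bool) × ℝ => lowerQuantile P Λ t.1.1 t.1.2 :=
    Measurable.comp (g := fun w : 𝒳 × Bool => lowerQuantile P Λ w.1 w.2)
      (f := fun t : (𝒳 × Bool) × ℝ => t.1) (measurable_lowerQuantile P Λ hΛ) (by fun_prop)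
  have hf : Measurable fun t : (𝒳 × Bool) × ℝ =>
      if t.2 < lowerQuantile P Λ t.1.1 t.1.2 then α t.1 else β t.1 :=
    Measurable.ite (measurableSet_lt measurable_snd hq) (by fun_prop) (by fun_prop)
  have hi : Integrable (fun z : Obs 𝒳 =>
      if z.2.1 < lowerQuantile P Λ z.1 z.2.2 then α (z.1, z.2.2) else β (z.1, z.2.2)) P :=
    Integrable.of_bound (hf.comp (hX.prodMk hY)).aestronglyMeasurable C
      (Filter.Eventually.of_forall fun z => by
        split_ifs
        · exact hαC _
        · exact hβC _)
  have hc := condExp_prod_ae_eq_integral_condDistrib hX hY.aemeasurable hf.stronglyMeasurable hi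
  rw [← integral_condExp hX.comap_le]
  refine integral_congr_ae (hc.trans ?_)
  filter_upwards [measureReal_Iio_lowerQuantile P Λ hΛ hatom] with z hz
  rw [integral_ite_lt, hz]

/-- For `Λ > 1`, given `X`, the value one has probability `Λ/(1+Λ)` among the treated and `1/(1+Λ)`
among the untreated, and the value zero the reverse. The likelihood ratios are thus `Λ` and `Λ⁻¹`,
and `worstPropensity` is the posterior. The residual is tested on events in `(X, U)`, integrating
out first the outcome, then the treatment. -/
lemma condExp_treatment_worstConfounder (hΛ : 1 ≤ Λ)
    (hatom : 1 < Λ → P {z | z.2.1 = lowerQuantile P Λ z.1 z.2.2} = 0) (i : Fin k) :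
    P[fun z => if z.2.2 = true then (1 : ℝ) else 0 |
      MeasurableSpace.comap (fun z : Obs 𝒳 => (z.1, worstConfounder k P Λ z)) inferInstance] =ᵐ[P]
        fun z => worstPropensity P Λ i (z.1, worstConfounder k P Λ z) := by
  have hc := measurable_worstConfounder k P Λ hΛ
  have hr := measurable_worstPropensity P Λ i
  have hxc : Measurable fun z : Obs 𝒳 => (z.1, worstConfounder k P Λ z) := measurable_fst.prodMk hc
  have hA : MeasurableSet {z : Obs 𝒳 | z.2.2 = true} :=
    (by fun_prop : Measurable fun z : Obs 𝒳 => z.2.2) (measurableSet_singleton true)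
  have h1i : Integrable (fun z : Obs 𝒳 => if z.2.2 = true then (1 : ℝ) else 0) P :=
    Integrable.of_bound (Measurable.ite hA measurable_const measurable_const).aestronglyMeasurable 1
      (Filter.Eventually.of_forall fun z => by split_ifs <;> simp)
  have hri : Integrable (fun z => worstPropensity P Λ i (z.1, worstConfounder k P Λ z)) P :=
    Integrable.of_bound (hr.comp hxc).aestronglyMeasurable 1
      (Filter.Eventually.of_forall fun z => by
        have := worstPropensity_mem_Icc P Λ hΛ i (z.1, worstConfounder k P Λ z)
        rw [Real.norm_of_nonneg this.1]
        exact this.2)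
  refine (ae_eq_condExp_of_forall_setIntegral_eq hxc.comap_le h1i
    (fun _ _ _ => hri.integrableOn) ?_ ((hr.comp (comap_measurable _)).aestronglyMeasurable)).symm
  rintro _ ⟨T, hT, rfl⟩ -
  rw [← sub_eq_zero, ← integral_sub hri.integrableOn h1i.integrableOn,
    ← integral_indicator (hxc hT)]
  set g : Bool → 𝒳 × (Fin k → ℝ) → ℝ := fun a =>
    T.indicator fun w => worstPropensity P Λ i w - if a = true then 1 else 0 with hg
  have hgm : ∀ a, Measurable (g a) := fun a => (hr.sub measurable_const).indicator hT
  have hgb : ∀ a w, ‖g a w‖ ≤ 1 := fun a w => by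
    refine (norm_indicator_le_norm_self _ _).trans ?_
    have := worstPropensity_mem_Icc P Λ hΛ i w
    rw [Real.norm_eq_abs, abs_le]
    split_ifs <;> constructor <;> linarith
  have hgg : ∀ w, propensity P true w.1 * worstOddsRatio Λ i w.2 * g true w +
      (1 - propensity P true w.1) * g false w = 0 := fun w => by
    by_cases hw : w ∈ T
    · simpa [hg, hw] using worstPropensity_balance P Λ hΛ i w
    · simp [hg, hw]
  have e : ∀ z : Obs 𝒳, ((fun z : Obs 𝒳 => (z.1, worstConfounder k P Λ z)) ⁻¹' T).indicator
      (fun z => worstPropensity P Λ i (z.1, worstConfounder k P Λ z) -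
        if z.2.2 = true then 1 else 0) z = g z.2.2 (z.1, worstConfounder k P Λ z) := fun z => by
    simp only [hg, Set.indicator]
    rfl
  simp only [e]
  have hKm : ∀ v : Bool → Fin k → ℝ, Measurable fun w : 𝒳 × Bool => g w.2 (w.1, v w.2) := fun v =>
    measurable_from_prod_countable_left fun a =>
      (hgm a).comp (f := fun x : 𝒳 => (x, v a)) (measurable_id.prodMk measurable_const)
  rcases hΛ.eq_or_lt with h | h
  -- For `Λ = 1` no atom condition is available; the confounder is constantly zero and the posterior
  -- is the nominal propensity.
  · have e2 : ∀ z : Obs 𝒳, worstConfounder k P Λ z = fun _ => 0 := fun z => by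
      funext _
      simp [worstConfounder, ← h]
    simp only [e2]
    refine integral_eq_zero_of_arm_average P (hKm fun _ _ => 0) (C := 1) (fun w => hgb _ _)
      fun x => ?_
    have := hgg (x, fun _ => 0)
    simpa [worstOddsRatio, ← h] using this
  -- `lo` and `hi` are the confounder values, per arm, on outcomes below the quantile and on the
  -- others.
  · set lo : Bool → Fin k → ℝ := fun a _ => if a = true then 0 else 1 with hlo
    set hi : Bool → Fin k → ℝ := fun a _ => if a = true then 1 else 0 with hhi
    have e2 : ∀ z : Obs 𝒳, g z.2.2 (z.1, worstConfounder k P Λ z) =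
        if z.2.1 < lowerQuantile P Λ z.1 z.2.2 then g z.2.2 (z.1, lo z.2.2)
          else g z.2.2 (z.1, hi z.2.2) := fun z => by
      split_ifs with hz
      · congr 2
        funext j
        cases hb : z.2.2
        · simp [worstConfounder, hlo, h, hb] at hz ⊢
          simp [hz]
        · simp [worstConfounder, hlo, h, hb] at hz ⊢
          simp [hz]
      · congr 2
        funext j
        cases hb : z.2.2
        · simp [worstConfounder, hhi, h, hb] at hz ⊢
          simp [hz]
        · simp [worstConfounder, hhi, h, hb] at hz ⊢
          simp [hz]
    simp only [e2]
    rw [integral_ite_lt_lowerQuantile P Λ hΛ (hatom h) (α := fun w => g w.2 (w.1, lo w.2))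
      (β := fun w => g w.2 (w.1, hi w.2)) (hKm lo) (hKm hi) (fun w => hgb _ _) (fun w => hgb _ _)]
    have hp := quantileLevel_pos Λ hΛ
    have hp1 := quantileLevel_lt_one Λ hΛ
    refine integral_eq_zero_of_arm_average P
      (K := fun w => g w.2 (w.1, lo w.2) * (1 / (1 + Λ)) + g w.2 (w.1, hi w.2) * (1 - 1 / (1 + Λ)))
      (((hKm lo).mul_const _).add ((hKm hi).mul_const _)) (C := 1) (fun w => ?_) fun x => ?_
    · have a1 := abs_le.1 (hgb w.2 (w.1, lo w.2))
      have a2 := abs_le.1 (hgb w.2 (w.1, hi w.2))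
      rw [Real.norm_eq_abs, abs_le]
      constructor <;> nlinarith
    -- The four terms are regrouped by confounder value: value one contributes `1/(1+Λ)` times its
    -- balance identity, value zero `Λ/(1+Λ)` times its own.
    · have b1 := hgg (x, fun _ => 1)
      have b0 := hgg (x, fun _ => 0)
      have hl : (1 : ℝ) - 1 / (1 + Λ) = Λ * (1 / (1 + Λ)) := by field_simp; ring
      simp only [worstOddsRatio, if_true, zero_ne_one, if_false] at b1 b0
      simp only [hlo, hhi, hl, if_true, Bool.false_eq_true, if_false]
      have hΛi : Λ * Λ⁻¹ = 1 := mul_inv_cancel₀ (by linarith)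
      linear_combination (1 / (1 + Λ)) * b1 + (Λ / (1 + Λ)) * b0 +
        -(1 / (1 + Λ)) * propensity P true x * g true (x, fun _ => 0) * hΛi

end WorstCase

/-! ### The least favourable law lies in the model and attains the bound -/

section WorstLaw

variable (k) (P : Measure (Obs 𝒳)) [IsProbabilityMeasure P] {Λ : ℝ} (hΛ : 1 ≤ Λ)

/-- The least favourable full-data law. -/
def worstLaw : Measure (Full 𝒳 k) := crossLaw P (measurable_worstConfounder k P Λ hΛ)

instance : IsProbabilityMeasure (worstLaw k P hΛ) := by unfold worstLaw; infer_instance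

lemma map_observed_worstLaw : (worstLaw k P hΛ).map observed = P := map_observed_crossLaw P _

variable {k} (hatom : 1 < Λ → P {z | z.2.1 = lowerQuantile P Λ z.1 z.2.2} = 0) (i : Fin k)

include hatom in
lemma truePropensity_worstLaw : truePropensity (worstLaw k P hΛ) =ᵐ[worstLaw k P hΛ]
    fun o => worstPropensity P Λ i (X o, U o) :=
  truePropensity_crossLaw P (measurable_worstConfounder k P Λ hΛ)
    (measurable_worstPropensity P Λ i) (condExp_treatment_worstConfounder P Λ hΛ hatom i)

variable (hoverlap : ∀ᵐ z ∂P, 0 < propensity P true z.1 ∧ propensity P true z.1 < 1)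

include hatom hoverlap i in
-- Overlap lets the nominal odds cancel, and the odds ratio then takes only the two extreme
-- admissible values.
theorem marginalSensitivity_worstLaw : MarginalSensitivity Λ (worstLaw k P hΛ) := by
  have hratio : ∀ᵐ o ∂(worstLaw k P hΛ),
      odds (truePropensity (worstLaw k P hΛ) o) / odds (nominalPropensity (worstLaw k P hΛ) o) =
        worstOddsRatio Λ i (U o) := by
    filter_upwards [truePropensity_worstLaw P hΛ hatom i,
      nominalPropensity_ae_eq (map_observed_worstLaw k P hΛ),
      ae_of_ae_observed (map_observed_worstLaw k P hΛ) hoverlap] with o h1 h2 h3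
    have h4 : 0 < odds (propensity P true (X o)) := odds_pos h3.1 h3.2
    rw [h1, h2, odds_worstPropensity P Λ hΛ, mul_div_cancel_left₀ _ h4.ne']
  have hinv : Λ⁻¹ ≤ Λ := (inv_le_one_of_one_le₀ hΛ).trans hΛ
  refine ⟨condIndepFun_crossLaw P _, ?_, ?_⟩
  · filter_upwards [hratio] with o ho
    rw [ho, worstOddsRatio, one_div]
    split_ifs
    · exact hinv
    · exact le_rfl
  · filter_upwards [hratio] with o ho
    rw [ho, worstOddsRatio]
    split_ifs
    · exact le_rfl
    · exact hinv

include hatom i in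
-- Low treated outcomes have confounder zero, so the odds of treatment shrink by `Λ` and those
-- against it grow by `Λ`; low untreated outcomes have confounder one, which multiplies the odds
-- against control by `Λ`. The restriction to `A = a` is needed because the confounder depends on
-- the observed outcome only.
lemma trueOddsAgainst_worstLaw (a : Bool) : ∀ᵐ o ∂(worstLaw k P hΛ), A o = a →
    trueOddsAgainst (worstLaw k P hΛ) a o = worstOddsAgainst P Λ a o := by
  filter_upwards [truePropensity_worstLaw P hΛ hatom i,
    confounder_crossLaw P (measurable_worstConfounder k P Λ hΛ)] with o h1 h2 hA
  have hobs : observed o = (X o, potential a o, a) := by rw [observed, hA]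
  rw [trueOddsAgainst, h1, worstOddsAgainst, tiltFactor_eq]
  have hU : worstOddsRatio Λ i (U o) =
      if a = true ↔ lowerQuantile P Λ (X o) a ≤ potential a o then Λ else Λ⁻¹ := by
    rw [h2, hobs, worstOddsRatio, worstConfounder]
    rcases hΛ.eq_or_lt with h | h
    · simp [← h]
    · simp [h]
  cases a
  · rw [oddsAgainst_false, odds_worstPropensity P Λ hΛ, hU, oddsAgainst_false]
    simp
  · rw [oddsAgainst_true, odds_worstPropensity P Λ hΛ, hU, oddsAgainst_true, mul_inv]
    by_cases h : potential true o < lowerQuantile P Λ (X o) true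
    · simp [h, not_le.2 h]
    · simp [h, not_lt.1 h]

end WorstLaw

/-! ### From conditional means to welfare -/

section Welfare

variable {Q : Measure (Full 𝒳 k)} [IsProbabilityMeasure Q] {P : Measure (Obs 𝒳)}
  [IsProbabilityMeasure P] {Λ : ℝ} {π : 𝒳 → ℝ}

/-- The lower bound on the conditional mean of `Y(π(X))`. -/
def policyLowerMean (P : Measure (Obs 𝒳)) [IsProbabilityMeasure P] (Λ : ℝ) (π : 𝒳 → ℝ) (x : 𝒳) :
    ℝ := lowerMean P Λ x true * π x + lowerMean P Λ x false * (1 - π x)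

lemma norm_policy_le (hπ : π ∈ allPolicies 𝒳) (x : 𝒳) : ‖π x‖ ≤ 1 ∧ ‖1 - π x‖ ≤ 1 := by
  obtain ⟨h0, h1⟩ := hπ.2 x
  rw [Real.norm_of_nonneg h0, Real.norm_of_nonneg (by linarith)]
  exact ⟨h1, by linarith⟩

lemma integrable_policyOutcome (hπ : π ∈ allPolicies 𝒳)
    (hY : ∀ a, Integrable (potential a) Q) : Integrable (policyOutcome π) Q := by
  have hm : Measurable fun o : Full 𝒳 k => π (X o) := hπ.1.comp measurable_X
  exact ((hY true).bdd_mul hm.aestronglyMeasurable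
    (Filter.Eventually.of_forall fun o => (norm_policy_le hπ (X o)).1)).add
    ((hY false).bdd_mul (measurable_const.sub hm).aestronglyMeasurable
      (Filter.Eventually.of_forall fun o => (norm_policy_le hπ (X o)).2))

lemma condExp_policyOutcome (hπ : π ∈ allPolicies 𝒳) (hY : ∀ a, Integrable (potential a) Q) :
    Q[policyOutcome π | sigmaX 𝒳 k] =ᵐ[Q] fun o =>
      (Q[potential true | sigmaX 𝒳 k]) o * π (X o) +
        (Q[potential false | sigmaX 𝒳 k]) o * (1 - π (X o)) := by
  have hm : Measurable[sigmaX 𝒳 k] fun o : Full 𝒳 k => π (X o) :=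
    hπ.1.comp (comap_measurable _)
  have hm' : Measurable[sigmaX 𝒳 k] fun o : Full 𝒳 k => 1 - π (X o) :=
    (measurable_const.sub hπ.1).comp (comap_measurable _)
  have i1 : Integrable ((fun o : Full 𝒳 k => π (X o)) * potential true) Q :=
    (hY true).bdd_mul (hm.mono sigmaX_le le_rfl).aestronglyMeasurable
      (Filter.Eventually.of_forall fun o => (norm_policy_le hπ (X o)).1)
  have i2 : Integrable ((fun o : Full 𝒳 k => 1 - π (X o)) * potential false) Q :=
    (hY false).bdd_mul (hm'.mono sigmaX_le le_rfl).aestronglyMeasurable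
      (Filter.Eventually.of_forall fun o => (norm_policy_le hπ (X o)).2)
  have e : (policyOutcome π : Full 𝒳 k → ℝ) = (fun o : Full 𝒳 k => π (X o)) * potential true +
      (fun o : Full 𝒳 k => 1 - π (X o)) * potential false := by
    funext o
    rfl
  rw [e]
  filter_upwards [condExp_add i1 i2 (sigmaX 𝒳 k),
    condExp_mul_of_stronglyMeasurable_left hm.stronglyMeasurable i1 (hY true),
    condExp_mul_of_stronglyMeasurable_left hm'.stronglyMeasurable i2 (hY false)] with o h1 h2 h3
  rw [h1, Pi.add_apply, h2, h3, Pi.mul_apply, Pi.mul_apply]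
  ring

lemma measurable_policyLowerMean (hΛ : 1 ≤ Λ) (hπ : π ∈ allPolicies 𝒳) :
    Measurable (policyLowerMean P Λ π) :=
  ((measurable_lowerMean P Λ hΛ true).mul hπ.1).add
    ((measurable_lowerMean P Λ hΛ false).mul (measurable_const.sub hπ.1))

lemma integral_policyLowerMean (hΛ : 1 ≤ Λ) (hπ : π ∈ allPolicies 𝒳) (hP : Q.map observed = P) :
    ∫ z, policyLowerMean P Λ π z.1 ∂P = ∫ o, policyLowerMean P Λ π (X o) ∂Q := by
  have h := integral_map (μ := Q) measurable_observed.aemeasurable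
    ((measurable_policyLowerMean (P := P) hΛ hπ).comp
      (measurable_fst (β := ℝ × Bool))).aestronglyMeasurable
  rw [hP] at h
  exact h

lemma integrable_policyLowerMean_iff (hΛ : 1 ≤ Λ) (hπ : π ∈ allPolicies 𝒳)
    (hP : Q.map observed = P) : Integrable (fun z : Obs 𝒳 => policyLowerMean P Λ π z.1) P ↔
      Integrable (fun o => policyLowerMean P Λ π (X o)) Q := by
  have h := integrable_map_measure (μ := Q)
    ((measurable_policyLowerMean (P := P) hΛ hπ).comp
      (measurable_fst (β := ℝ × Bool))).aestronglyMeasurable measurable_observed.aemeasurable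
  rw [hP] at h
  exact h

/-- Integrability of the bound is a conclusion: the bound is almost surely the conditional mean of
an integrable outcome. -/
lemma integral_policyOutcome_of_eq (hπ : π ∈ allPolicies 𝒳)
    (hY : ∀ a, Integrable (potential a) Q)
    (h : ∀ a, ∀ᵐ o ∂Q, (Q[potential a | sigmaX 𝒳 k]) o = lowerMean P Λ (X o) a) :
    Integrable (fun o => policyLowerMean P Λ π (X o)) Q ∧
      ∫ o, policyOutcome π o ∂Q = ∫ o, policyLowerMean P Λ π (X o) ∂Q := by
  have e : Q[policyOutcome π | sigmaX 𝒳 k] =ᵐ[Q] fun o => policyLowerMean P Λ π (X o) := by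
    filter_upwards [condExp_policyOutcome hπ hY, h true, h false] with o h1 h2 h3
    rw [h1, h2, h3, policyLowerMean]
  refine ⟨integrable_condExp.congr e, ?_⟩
  rw [← integral_condExp sigmaX_le]
  exact integral_congr_ae e

lemma integral_policyOutcome_ge (hπ : π ∈ allPolicies 𝒳)
    (hY : ∀ a, Integrable (potential a) Q)
    (hi : Integrable (fun o => policyLowerMean P Λ π (X o)) Q)
    (h : ∀ a, ∀ᵐ o ∂Q, lowerMean P Λ (X o) a ≤ (Q[potential a | sigmaX 𝒳 k]) o) :
    ∫ o, policyLowerMean P Λ π (X o) ∂Q ≤ ∫ o, policyOutcome π o ∂Q := by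
  rw [← integral_condExp sigmaX_le (f := policyOutcome π)]
  refine integral_mono_ae hi integrable_condExp ?_
  filter_upwards [condExp_policyOutcome hπ hY, h true, h false] with o h1 h2 h3
  obtain ⟨h4, h5⟩ := hπ.2 (X o)
  rw [h1, policyLowerMean]
  exact add_le_add (mul_le_mul_of_nonneg_right h2 h4)
    (mul_le_mul_of_nonneg_right h3 (by linarith))

lemma firstBestPolicy_mem (hΛ : 1 ≤ Λ) : firstBestPolicy P Λ ∈ allPolicies 𝒳 := by
  refine ⟨Measurable.ite (measurableSet_lt measurable_const
    ((measurable_lowerMean P Λ hΛ true).sub (measurable_lowerMean P Λ hΛ false)))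
    measurable_const measurable_const, fun x => ?_⟩
  unfold firstBestPolicy
  split_ifs <;> simp

/-- The bound is affine in `π x`, with slope the difference of the two lower means. -/
lemma policyLowerMean_le_firstBest (hπ : π ∈ allPolicies 𝒳) (x : 𝒳) :
    policyLowerMean P Λ π x ≤ policyLowerMean P Λ (firstBestPolicy P Λ) x := by
  obtain ⟨h0, h1⟩ := hπ.2 x
  unfold policyLowerMean firstBestPolicy
  split_ifs with h
  · nlinarith
  · nlinarith

end Welfare

end MSMPolicy

end

/-! ### The theorem -/

open MSMPolicy MSMPolicy.Full in
theorem theorem1 {𝒳 : Type*} [MeasurableSpace 𝒳] [StandardBorelSpace 𝒳]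
    (k : ℕ) (hk : 1 ≤ k) (Λ : ℝ) (hΛ : 1 ≤ Λ)
    -- the law of the observed data `(X, Y, A)`
    (P : Measure (Obs 𝒳)) [IsProbabilityMeasure P]
    -- the true law of the full data: it induces `P` and satisfies the sensitivity model
    (Po : Measure (Full 𝒳 k)) [IsProbabilityMeasure Po]
    (hobs : Po.map observed = P) (hMSM : MarginalSensitivity Λ Po)
    -- the potential outcomes have finite means
    (hint1 : Integrable Y1 Po) (hint0 : Integrable Y0 Po)
    -- for `Λ > 1`, the law of `Y` given `(X, A)` has almost surely no atom at its quantile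
    (hatom : 1 < Λ → P {z | z.2.1 = lowerQuantile P Λ z.1 z.2.2} = 0) :
    -- closed form of the worst-case welfare, all quantities being well defined
    (∀ π ∈ allPolicies 𝒳,
      (∀ Q ∈ uncertaintySet k P Λ, Integrable (policyOutcome π) (Q : Measure (Full 𝒳 k))) ∧
      Integrable (fun z : Obs 𝒳 =>
        lowerMean P Λ z.1 true * π z.1 + lowerMean P Λ z.1 false * (1 - π z.1)) P ∧
      IsGLB (welfareValues k P Λ π)
        (∫ z, (lowerMean P Λ z.1 true * π z.1 + lowerMean P Λ z.1 false * (1 - π z.1)) ∂P) ∧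
      worstCaseWelfare k P Λ π =
        ∫ z, (lowerMean P Λ z.1 true * π z.1 + lowerMean P Λ z.1 false * (1 - π z.1)) ∂P) ∧
    -- `μ⁻` is the sharp lower bound for the conditional means of the potential outcomes
    (∀ Q ∈ uncertaintySet k P Λ, ∀ a : Bool, ∀ᵐ o ∂(Q : Measure (Full 𝒳 k)),
      lowerMean P Λ (X o) a ≤ ((Q : Measure (Full 𝒳 k))[potential a | sigmaX 𝒳 k]) o) ∧
    (∃ Q ∈ uncertaintySet k P Λ, ∀ a : Bool, ∀ᵐ o ∂(Q : Measure (Full 𝒳 k)),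
      ((Q : Measure (Full 𝒳 k))[potential a | sigmaX 𝒳 k]) o = lowerMean P Λ (X o) a) ∧
    -- the first-best policy
    (firstBestPolicy P Λ ∈ allPolicies 𝒳 ∧
      ∀ π ∈ allPolicies 𝒳, worstCaseWelfare k P Λ π ≤ worstCaseWelfare k P Λ (firstBestPolicy P Λ))
    := by
  have hYo : ∀ a, Integrable (potential a) Po := fun a => by cases a <;> assumption
  -- The observed law carries the finite-mean condition from `Po` to every other law in the
  -- uncertainty set.
  have hIW : ∀ a, Integrable (inverseWeighted P a) P := fun a =>
    (integrable_potential_iff hΛ hMSM hobs a).1 (hYo a)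
  have hY : ∀ Q ∈ uncertaintySet k P Λ, ∀ a, Integrable (potential a) (Q : Measure (Full 𝒳 k)) :=
    fun Q hQ a => (integrable_potential_iff hΛ hQ.1 hQ.2 a).2 (hIW a)
  have hge : ∀ Q ∈ uncertaintySet k P Λ, ∀ a, ∀ᵐ o ∂(Q : Measure (Full 𝒳 k)),
      lowerMean P Λ (X o) a ≤ ((Q : Measure (Full 𝒳 k))[potential a | sigmaX 𝒳 k]) o :=
    fun Q hQ a => lowerMean_le_condExp_potential hΛ hQ.1 hQ.2 hatom a (hY Q hQ a)
  have hoverlap : ∀ᵐ z ∂P, 0 < propensity P true z.1 ∧ propensity P true z.1 < 1 := by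
    have hm : Measurable fun z : Obs 𝒳 => propensity P true z.1 := by fun_prop
    have h := ae_map_iff (μ := Po)
      (p := fun z : Obs 𝒳 => 0 < propensity P true z.1 ∧ propensity P true z.1 < 1)
      measurable_observed.aemeasurable
      ((measurableSet_lt measurable_const hm).inter (measurableSet_lt hm measurable_const))
    rw [hobs] at h
    refine h.2 ?_
    filter_upwards [propensities_of_marginalSensitivity hΛ hMSM hobs] with o ho using ho.2.1
  -- Some coordinate is needed to read off the confounder, whose coordinates all agree; this is
  -- where `1 ≤ k` enters.
  let i : Fin k := ⟨0, hk⟩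
  let Qw : ProbabilityMeasure (Full 𝒳 k) := ⟨worstLaw k P hΛ, inferInstance⟩
  have hQw : Qw ∈ uncertaintySet k P Λ :=
    ⟨marginalSensitivity_worstLaw P hΛ hatom i hoverlap, map_observed_worstLaw k P hΛ⟩
  have heq : ∀ a : Bool, ∀ᵐ o ∂(Qw : Measure (Full 𝒳 k)),
      ((Qw : Measure (Full 𝒳 k))[potential a | sigmaX 𝒳 k]) o = lowerMean P Λ (X o) a := fun a =>
    condExp_potential_eq_lowerMean hΛ hQw.1 hQw.2 a (hY Qw hQw a)
      (trueOddsAgainst_worstLaw P hΛ hatom i a)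
  have hint : ∀ π ∈ allPolicies 𝒳, Integrable (fun z : Obs 𝒳 => policyLowerMean P Λ π z.1) P :=
    fun π hπ => (integrable_policyLowerMean_iff hΛ hπ hQw.2).2
      (integral_policyOutcome_of_eq hπ (hY Qw hQw) heq).1
  -- The infimum is a minimum, attained at `Qw` for all policies simultaneously.
  have hleast : ∀ π ∈ allPolicies 𝒳,
      IsLeast (welfareValues k P Λ π) (∫ z, policyLowerMean P Λ π z.1 ∂P) := fun π hπ => by
    refine ⟨⟨Qw, hQw, ?_⟩, ?_⟩
    · rw [integral_policyLowerMean hΛ hπ hQw.2]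
      exact (integral_policyOutcome_of_eq hπ (hY Qw hQw) heq).2
    · rintro _ ⟨Q, hQ, rfl⟩
      rw [integral_policyLowerMean hΛ hπ hQ.2]
      exact integral_policyOutcome_ge hπ (hY Q hQ)
        ((integrable_policyLowerMean_iff hΛ hπ hQ.2).1 (hint π hπ)) (hge Q hQ)
  have hworst : ∀ π ∈ allPolicies 𝒳,
      worstCaseWelfare k P Λ π = ∫ z, policyLowerMean P Λ π z.1 ∂P := fun π hπ =>
    (hleast π hπ).csInf_eq
  refine ⟨fun π hπ => ⟨fun Q hQ => integrable_policyOutcome hπ (hY Q hQ), hint π hπ,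
    (hleast π hπ).isGLB, hworst π hπ⟩, hge, ⟨Qw, hQw, heq⟩, firstBestPolicy_mem hΛ,
    fun π hπ => ?_⟩
  rw [hworst π hπ, hworst _ (firstBestPolicy_mem hΛ)]
  exact integral_mono (hint π hπ) (hint _ (firstBestPolicy_mem hΛ)) fun z =>
    policyLowerMean_le_firstBest hπ z.1
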